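/- For a natural number $N$, consider the $2(2N+1)$-dimensional space of plane curves $\varphi\mapsto(x(\varphi),y(\varphi))$, $\varphi\in\mathbb R/2\pi\mathbb Z$, whose two components are real trigonometric polynomials of degree at most $N$, $$x(\varphi)=a_0+\sum_{j=1}^N (a_j\cos j\varphi+b_j\sin j\varphi),\qquad y(\varphi)=\tilde a_0+\sum_{j=1}^N(\tilde a_j\cos j\varphi+\tilde b_j\sin j\varphi),$$ with the Euclidean structure given by the scalar product $\frac1\pi\int_0^{2\pi}(x_1x_2+y_1y_2)\,d\varphi$ of the curves $(x_1,y_1)$ and $(x_2,y_2)$. For $R>0$ let $B(N,R)$ be the ball of radius $R$ centered at the origin of this space, and let $A_i(N,R)$ be the relative volume (the volume divided by the volume of $B(N,R)\times B(N,R)$) of the set of pairs $(f,g)\in B(N,R)\times B(N,R)$ such that the two curves $f$ and $g$ have exactly $i$ intersection points (these numbers do not in fact depend on $R$). Then, for every $R>0$, the average number of intersection points $\sum_{i=0}^\infty i\,A_i(N,R)$ is finite for every $N$ and satisfies $$\sum_{i=0}^\infty i\cdot A_i(N,R)=\frac{\pi}{3}N^2+O(N)\qquad (N\to\infty),$$ where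 the constant in $O(N)$ is independent of $R$. -/

import Mathlib

open scoped BigOperators

namespace TrigCurve

/-- Labels of the Fourier modes of degree at most `N`: the constant mode, the modes
`cos ((j+1) φ)` and the modes `sin ((j+1) φ)`, with `j : Fin N`. -/
abbrev Mode (N : ℕ) : Type := Unit ⊕ (Fin N ⊕ Fin N)

/-- The `2(2N+1)`-dimensional Euclidean space of plane curves given by pairs of Fourier polynomials
of degree at most `N`. A curve is recorded by its coordinates in the basis `1/√2`, `cos (jφ)`,
`sin (jφ)` of each of the two components, which is orthonormal for the scalar product
`(1/π) ∫₀^{2π} (x₁ x₂ + y₁ y₂) dφ`; see `inner_eq_integral`. -/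
abbrev CurveSpace (N : ℕ) : Type := EuclideanSpace ℝ (Fin 2 × Mode N)

/-- The Fourier polynomial `a₀ + ∑ a_j cos (jφ) + ∑ b_j sin (jφ)` that is the component
`i` of the curve `c` (`i = 0` for `x`, `i = 1` for `y`); here `a₀ = c (i, inl ()) / √2`. -/
noncomputable def component {N : ℕ} (c : CurveSpace N) (i : Fin 2) (φ : ℝ) : ℝ :=
  c (i, Sum.inl ()) / √2
    + ∑ j : Fin N, c (i, Sum.inr (Sum.inl j)) * Real.cos (((j : ℕ) + 1 : ℝ) * φ)
    + ∑ j : Fin N, c (i, Sum.inr (Sum.inr j)) * Real.sin (((j : ℕ) + 1 : ℝ) * φ)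

/-- The `2π`-periodic parametrized plane curve `φ ↦ (x φ, y φ)`. -/
noncomputable def curve {N : ℕ} (c : CurveSpace N) (φ : ℝ) : EuclideanSpace ℝ (Fin 2) :=
  !₂[component c 0 φ, component c 1 φ]

/-- The number of intersection points of two plane curves: the number of points of the plane which
lie on both of them (the curves are `2π`-periodic, so the range over `ℝ` is the image of the
circle). -/
noncomputable def intersectionNumber {N : ℕ} (p : CurveSpace N × CurveSpace N) : ℕ∞ :=
  (Set.range (curve p.1) ∩ Set.range (curve p.2)).encard

/-- The space of pairs of curves whose norms are at most `R`. -/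
def ballPairs (N : ℕ) (R : ℝ) : Set (CurveSpace N × CurveSpace N) :=
  Metric.closedBall 0 R ×ˢ Metric.closedBall 0 R

/-- The relative volume, in the space of pairs of curves with norms at most `R`, of the set of pairs
with exactly `i` intersection points. -/
noncomputable def relVolume (N : ℕ) (R : ℝ) (i : ℕ) : ℝ :=
  MeasureTheory.volume.real {p ∈ ballPairs N R | intersectionNumber p = (i : ℕ∞)}
    / MeasureTheory.volume.real (ballPairs N R)

/-- The orthonormal trigonometric functions `1/√2`, `cos (jφ)`, `sin (jφ)`. -/
noncomputable def modeFun {N : ℕ} : Mode N → ℝ → ℝ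
  | Sum.inl _, _ => 1 / √2
  | Sum.inr (Sum.inl j), φ => Real.cos (((j : ℕ) + 1 : ℝ) * φ)
  | Sum.inr (Sum.inr j), φ => Real.sin (((j : ℕ) + 1 : ℝ) * φ)

theorem continuous_modeFun {N : ℕ} (k : Mode N) : Continuous (modeFun k) := by
  rcases k with _ | j | j <;> (unfold modeFun; fun_prop)

theorem component_eq_sum {N : ℕ} (c : CurveSpace N) (i : Fin 2) (φ : ℝ) :
    component c i φ = ∑ k : Mode N, c (i, k) * modeFun k φ := by
  simp [component, modeFun, Fintype.sum_sum_type, div_eq_mul_inv, add_assoc]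

theorem integral_cos_int (m : ℤ) :
    ∫ φ in (0 : ℝ)..(2 * Real.pi), Real.cos ((m : ℝ) * φ) = if m = 0 then 2 * Real.pi else 0 := by
  split_ifs with h
  · simp [h]
  · have hm : (m : ℝ) ≠ 0 := by exact_mod_cast h
    have h2 : Real.sin ((m : ℝ) * (2 * Real.pi)) = 0 := by
      have := Real.sin_int_mul_pi (2 * m)
      push_cast at this
      rw [← this]; congr 1; ring
    rw [intervalIntegral.integral_comp_mul_left (fun x => Real.cos x) hm, integral_cos, h2]
    simp

theorem integral_sin_int (m : ℤ) :
    ∫ φ in (0 : ℝ)..(2 * Real.pi), Real.sin ((m : ℝ) * φ) = 0 := by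
  by_cases h : m = 0
  · simp [h]
  · have hm : (m : ℝ) ≠ 0 := by exact_mod_cast h
    rw [intervalIntegral.integral_comp_mul_left (fun x => Real.sin x) hm, integral_sin,
      Real.cos_int_mul_two_pi]
    simp

theorem integral_cos_mul_cos (m n : ℤ) :
    ∫ φ in (0 : ℝ)..(2 * Real.pi), Real.cos ((m : ℝ) * φ) * Real.cos ((n : ℝ) * φ)
      = ((if m - n = 0 then 2 * Real.pi else 0) + (if m + n = 0 then 2 * Real.pi else 0)) / 2 := by
  rw [← integral_cos_int, ← integral_cos_int, ← intervalIntegral.integral_add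
    (by apply Continuous.intervalIntegrable; fun_prop)
    (by apply Continuous.intervalIntegrable; fun_prop), ← intervalIntegral.integral_div]
  congr 1; ext φ
  push_cast
  rw [sub_mul, add_mul, Real.cos_sub, Real.cos_add]; ring

theorem integral_sin_mul_sin (m n : ℤ) :
    ∫ φ in (0 : ℝ)..(2 * Real.pi), Real.sin ((m : ℝ) * φ) * Real.sin ((n : ℝ) * φ)
      = ((if m - n = 0 then 2 * Real.pi else 0) - (if m + n = 0 then 2 * Real.pi else 0)) / 2 := by
  rw [← integral_cos_int, ← integral_cos_int, ← intervalIntegral.integral_sub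
    (by apply Continuous.intervalIntegrable; fun_prop)
    (by apply Continuous.intervalIntegrable; fun_prop), ← intervalIntegral.integral_div]
  congr 1; ext φ
  push_cast
  rw [sub_mul, add_mul, Real.cos_sub, Real.cos_add]; ring

theorem integral_sin_mul_cos (m n : ℤ) :
    ∫ φ in (0 : ℝ)..(2 * Real.pi), Real.sin ((m : ℝ) * φ) * Real.cos ((n : ℝ) * φ) = 0 := by
  have h : (fun φ : ℝ => Real.sin ((m : ℝ) * φ) * Real.cos ((n : ℝ) * φ))
      = fun φ => (Real.sin (((m + n : ℤ) : ℝ) * φ) + Real.sin (((m - n : ℤ) : ℝ) * φ)) / 2 := by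
    ext φ
    push_cast
    rw [sub_mul, add_mul, Real.sin_sub, Real.sin_add]; ring
  rw [h, intervalIntegral.integral_div, intervalIntegral.integral_add
    (by apply Continuous.intervalIntegrable; fun_prop)
    (by apply Continuous.intervalIntegrable; fun_prop), integral_sin_int, integral_sin_int]
  simp

theorem integral_modeFun_mul {N : ℕ} (k l : Mode N) :
    ∫ φ in (0 : ℝ)..(2 * Real.pi), modeFun k φ * modeFun l φ = if k = l then Real.pi else 0 := by
  have e (j : Fin N) : ((j : ℕ) + 1 : ℝ) = (((j : ℕ) + 1 : ℤ) : ℝ) := by push_cast; rfl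
  have hd (j j' : Fin N) : ((j : ℕ) + 1 : ℤ) - ((j' : ℕ) + 1 : ℤ) = 0 ↔ j = j' := by
    rw [Fin.ext_iff]; omega
  have hs (j j' : Fin N) : ¬ ((j : ℕ) + 1 : ℤ) + ((j' : ℕ) + 1 : ℤ) = 0 := by omega
  have h0 (j : Fin N) : ¬ ((j : ℕ) + 1 : ℤ) = 0 := by omega
  have hsc (m n : ℤ) : ∫ φ in (0 : ℝ)..(2 * Real.pi),
      Real.cos ((m : ℝ) * φ) * Real.sin ((n : ℝ) * φ) = 0 := by
    simp_rw [mul_comm (Real.cos _)]; exact integral_sin_mul_cos n m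
  rcases k with _ | j | j <;> rcases l with _ | j' | j' <;>
    simp only [modeFun, e, intervalIntegral.integral_const_mul, intervalIntegral.integral_mul_const,
      integral_cos_int, integral_sin_int, integral_cos_mul_cos, integral_sin_mul_sin,
      integral_sin_mul_cos, hsc, hd, hs, h0, Sum.inl.injEq, Sum.inr.injEq, reduceCtorEq, if_false,
      mul_zero, zero_mul, add_zero, sub_zero]
  · have h : (1 / √2 * (1 / √2) : ℝ) = 1 / 2 := by
      rw [div_mul_div_comm, Real.mul_self_sqrt (by norm_num)]; norm_num
    rw [intervalIntegral.integral_const, smul_eq_mul, mul_left_comm, h, if_pos trivial]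
    ring
  all_goals split_ifs <;> ring

/-- The scalar product of `CurveSpace N` is the `L₂` scalar product of curves. -/
theorem inner_eq_integral {N : ℕ} (c d : CurveSpace N) :
    inner ℝ c d = 1 / Real.pi * ∫ φ in (0 : ℝ)..(2 * Real.pi),
      (component c 0 φ * component d 0 φ + component c 1 φ * component d 1 φ) := by
  have key (i : Fin 2) : ∫ φ in (0 : ℝ)..(2 * Real.pi), component c i φ * component d i φ
      = Real.pi * ∑ k : Mode N, c (i, k) * d (i, k) := by
    simp_rw [component_eq_sum, Finset.sum_mul_sum]
    have hc (k l : Mode N) : Continuous fun φ : ℝ =>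
        c (i, k) * modeFun k φ * (d (i, l) * modeFun l φ) := by
      have := continuous_modeFun k
      have := continuous_modeFun l
      fun_prop
    rw [intervalIntegral.integral_finsetSum fun k _ =>
      (continuous_finsetSum _ fun l _ => hc k l).intervalIntegrable _ _, Finset.mul_sum]
    refine Finset.sum_congr rfl fun k _ => ?_
    rw [intervalIntegral.integral_finsetSum fun l _ => (hc k l).intervalIntegrable _ _]
    simp_rw [mul_mul_mul_comm _ (modeFun k _), intervalIntegral.integral_const_mul,
      integral_modeFun_mul]
    simp [mul_comm]
  have hcomp (e : CurveSpace N) (i : Fin 2) : Continuous (component e i) := by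
    unfold component; fun_prop
  have hint (i : Fin 2) : IntervalIntegrable (fun φ => component c i φ * component d i φ)
      MeasureTheory.volume 0 (2 * Real.pi) :=
    ((hcomp c i).mul (hcomp d i)).intervalIntegrable _ _
  rw [intervalIntegral.integral_add (hint 0) (hint 1), key, key, ← mul_add,
    ← mul_assoc, one_div, inv_mul_cancel₀ Real.pi_ne_zero, one_mul]
  simp [PiLp.inner_apply, Fintype.sum_prod_type, mul_comm]

end TrigCurve

namespace TrigCurve

open Set MeasureTheory Filter Topology
open scoped ENNReal

/-! This is a Kac–Rice argument that gives the mean exactly, as `meanValue N`; the asymptotics are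
then a Wallis estimate.

For positive `N`, almost every pair of curves has as many intersection points as parameter pairs
`(φ, ψ)` in one period with `f φ = g ψ` (`ae_intersectionNumber_eq`): the count can only drop when
one curve passes through a double point of the other, which is four equations in three parameters,
hence null (`volume_tripleSet`).

Translations of `f` are coordinates of the curve space. With all else fixed, the parameter pairs are
the fibre of a `C¹` map of the plane over the translation vector, so the area formula
(`lintegral_encard_preimage_mul`) turns their mean number into an integral over `(φ, ψ)` of the area
spanned by the two velocities, over pairs that meet there. Position and velocity at a parameter are
four orthogonal functionals whose norms do not depend on the parameter (`orthonormal_rowVectors`).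
Their joint law in the ball is therefore an explicit radial density, the same at each parameter, and
the integral over `(φ, ψ)` is a factor `4 π²` (`lintegral_ballPairs_intersectionNumber`).

Polar coordinates reduce what remains to the square of one radial moment, and the powers of `R`
cancel against the volume of the ball pairs (`lintegral_intersectionNumber_eq`). That moment is a
Wallis integral up to a factor (`radialMoment_eq`), and the elementary two-sided Wallis bounds give
the error `O(N)` (`abs_meanValue_sub_le`). -/

/-! ### Measurability of the intersection number -/

/-- An open set is a countable union of closed ones, so the set is σ-compact and its projection is a
countable union of compact sets. No theory of analytic sets is needed. -/
theorem measurableSet_image_fst {P T : Type*} [PseudoEMetricSpace P] [PseudoEMetricSpace T]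
    [T2Space P] [SigmaCompactSpace P] [SigmaCompactSpace T] [MeasurableSpace P] [BorelSpace P]
    {C U : Set (P × T)} (hC : IsClosed C) (hU : IsOpen U) :
    MeasurableSet (Prod.fst '' (C ∩ U)) := by
  obtain ⟨F, hF, -, hFU, -⟩ := hU.exists_iUnion_isClosed
  rw [← hFU, inter_iUnion, image_iUnion]
  refine MeasurableSet.iUnion fun n => ?_
  have : IsSigmaCompact (Prod.fst '' (C ∩ F n) : Set P) :=
    (isSigmaCompact_univ.of_isClosed_subset (hC.inter (hF n)) (subset_univ _)).image
      continuous_fst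
  obtain ⟨K, hK, hKU⟩ := this
  rw [← hKU]
  exact MeasurableSet.iUnion fun m => (hK m).isClosed.measurableSet

/-- Finitely many points of a Hausdorff space have disjoint basic neighbourhoods. The point is that
only countably many families `u` have to be tested. -/
theorem natCast_le_encard_iff {Y : Type*} [TopologicalSpace Y] [T2Space Y]
    [SecondCountableTopology Y] (S : Set Y) (k : ℕ) :
    (k : ℕ∞) ≤ S.encard ↔ ∃ u : Fin k → TopologicalSpace.countableBasis Y,
      Pairwise (fun i j => Disjoint (u i : Set Y) (u j : Set Y)) ∧
        ∀ i, (S ∩ (u i : Set Y)).Nonempty := by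
  constructor
  · intro h
    obtain ⟨T, hTS, hT⟩ := exists_subset_encard_eq h
    have hfin : T.Finite := finite_of_encard_eq_coe hT
    obtain ⟨U, hU, hdis⟩ := hfin.t2_separation
    have hcard : Nat.card T = k := by
      have := hfin.cast_ncard_eq
      rw [hT] at this
      rw [Nat.card_coe_set_eq]; exact_mod_cast this
    have := hfin.to_subtype
    let e : Fin k ≃ T := (Finite.equivFinOfCardEq hcard).symm
    have hb : ∀ i : Fin k, ∃ v : TopologicalSpace.countableBasis Y, (e i : Y) ∈ (v : Set Y) ∧
        (v : Set Y) ⊆ U (e i) := by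
      intro i
      obtain ⟨v, hv, h1, h2⟩ :=
        (TopologicalSpace.isBasis_countableBasis Y).exists_subset_of_mem_open (hU (e i)).1 (hU (e i)).2
      exact ⟨⟨v, hv⟩, h1, h2⟩
    choose v hv1 hv2 using hb
    refine ⟨v, fun i j hij => ?_, fun i => ⟨e i, hTS (e i).2, hv1 i⟩⟩
    exact (hdis (e i).2 (e j).2 (fun h => hij (e.injective (Subtype.ext h)))).mono (hv2 i) (hv2 j)
  · rintro ⟨u, hu, hne⟩
    choose y hy using hne
    have hinj : Function.Injective y := by
      intro i j hij
      by_contra hne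
      exact (Set.disjoint_left.1 (hu hne)) (hy i).2 (hij ▸ (hy j).2)
    calc (k : ℕ∞) = (range y).encard := by
            rw [← image_univ, hinj.encard_image, encard_univ]; simp
      _ ≤ S.encard := encard_le_encard (by rintro _ ⟨i, rfl⟩; exact (hy i).1)

theorem measurable_encard {P Y : Type*} [MeasurableSpace P] [TopologicalSpace Y] [T2Space Y]
    [SecondCountableTopology Y] {S : P → Set Y}
    (h : ∀ U, IsOpen U → MeasurableSet {p | (S p ∩ U).Nonempty}) :
    Measurable fun p => (S p).encard := by
  have key : ∀ k : ℕ, MeasurableSet {p | (k : ℕ∞) ≤ (S p).encard} := by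
    intro k
    simp_rw [natCast_le_encard_iff, ofPred_exists]
    refine MeasurableSet.iUnion fun u => ?_
    refine (MeasurableSet.const _).inter ?_
    have : MeasurableSet (⋂ i, {p | (S p ∩ (u i : Set Y)).Nonempty}) := MeasurableSet.iInter
      fun i => h _ (TopologicalSpace.isOpen_of_mem_countableBasis (u i).2)
    rwa [← ofPred_forall] at this
  refine measurable_to_countable' fun x => ?_
  induction x using ENat.recTopCoe with
  | top =>
    have : (fun p => (S p).encard) ⁻¹' {⊤} = ⋂ k : ℕ, {p | (k : ℕ∞) ≤ (S p).encard} := by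
      ext p
      simp only [mem_preimage, mem_singleton_iff, mem_iInter, mem_ofPred_eq]
      exact ⟨fun h k => h ▸ le_top, fun h => ENat.eq_top_iff_forall_ge.2 h⟩
    rw [this]
    exact MeasurableSet.iInter key
  | coe k =>
    have : (fun p => (S p).encard) ⁻¹' {(k : ℕ∞)}
        = {p | (k : ℕ∞) ≤ (S p).encard} \ {p | ((k + 1 : ℕ) : ℕ∞) ≤ (S p).encard} := by
      ext p
      simp only [mem_preimage, mem_singleton_iff, Set.mem_sdiff, mem_ofPred_eq, Nat.cast_add,
        Nat.cast_one, ENat.add_one_le_iff (ENat.natCast_ne_top k), not_lt]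
      exact ⟨fun h => ⟨h.ge, h.le⟩, fun h => le_antisymm h.2 h.1⟩
    rw [this]
    exact (key k).diff (key (k + 1))

theorem continuous_component_uncurry {N : ℕ} (i : Fin 2) :
    Continuous fun q : CurveSpace N × ℝ => component q.1 i q.2 := by
  unfold component; fun_prop

theorem continuous_curve_uncurry {N : ℕ} :
    Continuous fun q : CurveSpace N × ℝ => curve q.1 q.2 := by
  unfold curve
  have := continuous_component_uncurry (N := N)
  refine (PiLp.continuous_toLp 2 _).comp (continuous_pi fun i => ?_)
  fin_cases i <;> simp [this]

theorem measurable_intersectionNumber {N : ℕ} :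
    Measurable (intersectionNumber (N := N)) := by
  refine measurable_encard fun U hU => ?_
  have hf : Continuous fun q : (CurveSpace N × CurveSpace N) × (ℝ × ℝ) => curve q.1.1 q.2.1 :=
    continuous_curve_uncurry.comp (f := fun q : (CurveSpace N × CurveSpace N) × (ℝ × ℝ) =>
      (q.1.1, q.2.1)) (by fun_prop)
  have hg : Continuous fun q : (CurveSpace N × CurveSpace N) × (ℝ × ℝ) => curve q.1.2 q.2.2 :=
    continuous_curve_uncurry.comp (f := fun q : (CurveSpace N × CurveSpace N) × (ℝ × ℝ) =>
      (q.1.2, q.2.2)) (by fun_prop)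
  convert! measurableSet_image_fst (isClosed_eq hf hg) (hU.preimage hf) using 1
  ext ⟨f, g⟩
  constructor
  · rintro ⟨y, ⟨⟨φ, hφ⟩, ⟨ψ, hψ⟩⟩, hy⟩
    refine ⟨((f, g), (φ, ψ)), ⟨?_, ?_⟩, rfl⟩
    · simp only [mem_ofPred_eq]; exact hφ.trans hψ.symm
    · simp only [mem_preimage]; exact hφ ▸ hy
  · rintro ⟨⟨p, φ, ψ⟩, ⟨h1, h2⟩, rfl⟩
    exact ⟨_, ⟨⟨φ, rfl⟩, ⟨ψ, h1.symm⟩⟩, h2⟩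

/-! ### The area formula with multiplicities -/

/-- Near a point where the derivative of a `C¹` map is invertible, the map is injective. -/
theorem exists_isOpen_injOn {E : Type*} [NormedAddCommGroup E] [NormedSpace ℝ E]
    [FiniteDimensional ℝ E] {f : E → E} (hf : ContDiff ℝ 1 f) {x : E}
    (hx : (fderiv ℝ f x).det ≠ 0) : ∃ U, IsOpen U ∧ x ∈ U ∧ InjOn f U := by
  have h1 : HasStrictFDerivAt f ((fderiv ℝ f x).toContinuousLinearEquivOfDetNeZero hx : E →L[ℝ] E)
      x := by
    convert! (hf.contDiffAt (x := x)).hasStrictFDerivAt (by simp) using 1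
  exact ⟨(h1.toOpenPartialHomeomorph f).source, (h1.toOpenPartialHomeomorph f).open_source,
    h1.mem_toOpenPartialHomeomorph_source, (h1.toOpenPartialHomeomorph f).injOn⟩

/-- The area formula with multiplicities for a `C¹` map. -/
theorem lintegral_encard_preimage_mul {E : Type*} [NormedAddCommGroup E] [NormedSpace ℝ E]
    [FiniteDimensional ℝ E] [MeasurableSpace E] [BorelSpace E] (μ : Measure E)
    [μ.IsAddHaarMeasure] {f : E → E} (hf : ContDiff ℝ 1 f) {A : Set E} (hA : MeasurableSet A)
    (h : E → ℝ≥0∞) (hh : Measurable h) :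
    ∫⁻ y, ((A ∩ f ⁻¹' {y}).encard : ℝ≥0∞) * h y ∂μ
      = ∫⁻ x in A, ENNReal.ofReal |(fderiv ℝ f x).det| * h (f x) ∂μ := by
  have hdiff : ∀ x, HasFDerivAt f (fderiv ℝ f x) x := fun x =>
    (hf.differentiable (by simp) x).hasFDerivAt
  have hcont : Continuous fun x => (fderiv ℝ f x).det :=
    ContinuousLinearMap.continuous_det.comp (hf.continuous_fderiv (by simp))
  set Z : Set E := {x | (fderiv ℝ f x).det = 0} with hZ
  have hZm : MeasurableSet Z := (isClosed_eq hcont continuous_const).measurableSet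
  -- Sard's theorem in equal dimensions: almost every fibre avoids the critical set.
  have hcrit : μ (f '' (A ∩ Z)) = 0 :=
    addHaar_image_eq_zero_of_det_fderivWithin_eq_zero μ
      (fun x _ => (hdiff x).hasFDerivWithinAt) fun x hx => hx.2
  have hU : ∀ x : E, ∃ U, IsOpen U ∧ (x ∉ Z → x ∈ U) ∧ InjOn f U := by
    intro x
    by_cases hx : x ∈ Z
    · exact ⟨∅, isOpen_empty, fun h => (h hx).elim, injOn_empty _⟩
    · obtain ⟨U, h1, h2, h3⟩ := exists_isOpen_injOn hf hx
      exact ⟨U, h1, fun _ => h2, h3⟩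
  choose U hUo hUx hUinj using hU
  obtain ⟨T, hTc, hT⟩ := TopologicalSpace.isOpen_iUnion_countable U hUo
  have hne : ∃ s : ℕ → Set E, (∀ n, IsOpen (s n)) ∧ (∀ n, InjOn f (s n)) ∧ Zᶜ ⊆ ⋃ n, s n := by
    have hsub : Zᶜ ⊆ ⋃ i ∈ T, U i := by
      rw [hT]; exact fun x hx => mem_iUnion.2 ⟨x, hUx x hx⟩
    rcases T.eq_empty_or_nonempty with h0 | h0
    · refine ⟨fun _ => ∅, fun _ => isOpen_empty, fun _ => injOn_empty _, ?_⟩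
      intro x hx
      simpa [h0] using hsub hx
    · obtain ⟨g, hg⟩ := hTc.exists_eq_range h0
      refine ⟨fun n => U (g n), fun n => hUo _, fun n => hUinj _, ?_⟩
      rw [hg] at hsub
      simpa using hsub
  obtain ⟨s, hso, hsinj, hsZ⟩ := hne
  -- Off the critical set `f` is locally injective, and by the Lindelöf property countably many such
  -- neighbourhoods suffice. Making them disjoint partitions `A \ Z` into measurable pieces on which
  -- `f` is injective, so each piece adds 0 or 1 to the count of a fibre.
  set D : ℕ → Set E := fun n => (A \ Z) ∩ disjointed s n with hD
  have hDm : ∀ n, MeasurableSet (D n) := fun n =>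
    (hA.diff hZm).inter (MeasurableSet.disjointed (fun n => (hso n).measurableSet) n)
  have hDinj : ∀ n, InjOn f (D n) := fun n =>
    (hsinj n).mono (inter_subset_right.trans (disjointed_subset s n))
  have hDdis : Pairwise (Function.onFun Disjoint D) := fun i j hij =>
    (disjoint_disjointed s hij).mono inter_subset_right inter_subset_right
  have hDU : ⋃ n, D n = A \ Z := by
    rw [hD, ← inter_iUnion, iUnion_disjointed]
    exact inter_eq_left.2 fun x hx => hsZ hx.2
  have himg : ∀ n, MeasurableSet (f '' D n) := fun n =>
    measurable_image_of_fderivWithin (hDm n) (fun x _ => (hdiff x).hasFDerivWithinAt) (hDinj n)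
  have hcount : ∀ y, y ∉ f '' (A ∩ Z) → ((A ∩ f ⁻¹' {y}).encard : ℝ≥0∞)
      = ∑' n, (f '' D n).indicator 1 y := by
    intro y hy
    have e1 : A ∩ f ⁻¹' {y} = ⋃ n, D n ∩ f ⁻¹' {y} := by
      rw [← iUnion_inter, hDU]
      ext x
      constructor
      · rintro ⟨h1, h2⟩
        exact ⟨⟨h1, fun hz => hy ⟨x, ⟨h1, hz⟩, h2⟩⟩, h2⟩
      · rintro ⟨h1, h2⟩
        exact ⟨h1.1, h2⟩
    have hm : ∀ n, MeasurableSet (D n ∩ f ⁻¹' {y}) := fun n =>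
      (hDm n).inter (hf.continuous.measurable (measurableSet_singleton y))
    rw [← Measure.count_apply (e1 ▸ MeasurableSet.iUnion hm), e1, measure_iUnion
      (fun i j hij => (hDdis hij).mono inter_subset_left inter_subset_left) hm]
    congr 1; ext n
    rw [Measure.count_apply (hm n)]
    by_cases hn : y ∈ f '' D n
    · obtain ⟨x, hx, rfl⟩ := hn
      have : D n ∩ f ⁻¹' {f x} = {x} := by
        ext z
        constructor
        · rintro ⟨h1, h2⟩
          exact hDinj n h1 hx h2
        · rintro rfl
          exact ⟨hx, rfl⟩
      rw [this, indicator_of_mem (mem_image_of_mem f hx)]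
      simp
    · have : D n ∩ f ⁻¹' {y} = ∅ := by
        ext z
        simp only [mem_inter_iff, mem_preimage, mem_singleton_iff, mem_empty_iff_false, iff_false]
        rintro ⟨h1, h2⟩
        exact hn ⟨z, h1, h2⟩
      rw [this, indicator_of_notMem hn]
      simp
  calc ∫⁻ y, ((A ∩ f ⁻¹' {y}).encard : ℝ≥0∞) * h y ∂μ
      = ∫⁻ y, ∑' n, (f '' D n).indicator h y ∂μ := by
        refine lintegral_congr_ae ?_
        filter_upwards [compl_mem_ae_iff.2 hcrit] with y hy
        rw [hcount y hy, ← ENNReal.tsum_mul_right]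
        congr 1; ext n
        by_cases hn : y ∈ f '' D n <;> simp [hn]
    _ = ∑' n, ∫⁻ y in f '' D n, h y ∂μ := by
        rw [lintegral_tsum fun n => (hh.indicator (himg n)).aemeasurable]
        congr 1; ext n
        rw [lintegral_indicator (himg n)]
    _ = ∑' n, ∫⁻ x in D n, ENNReal.ofReal |(fderiv ℝ f x).det| * h (f x) ∂μ := by
        congr 1; ext n
        exact lintegral_image_eq_lintegral_abs_det_fderiv_mul μ (hDm n)
          (fun x _ => (hdiff x).hasFDerivWithinAt) (hDinj n) h
    _ = ∫⁻ x in A \ Z, ENNReal.ofReal |(fderiv ℝ f x).det| * h (f x) ∂μ := by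
        rw [← hDU, lintegral_iUnion hDm hDdis]
    _ = ∫⁻ x in A, ENNReal.ofReal |(fderiv ℝ f x).det| * h (f x) ∂μ := by
        -- The critical points can be put back because the Jacobian vanishes there.
        rw [← lintegral_inter_add_sdiff (B := Z) _ A hZm]
        have : ∫⁻ x in A ∩ Z, ENNReal.ofReal |(fderiv ℝ f x).det| * h (f x) ∂μ = 0 := by
          rw [setLIntegral_congr_fun (g := fun _ => 0) (hA.inter hZm)]
          · simp
          · intro x hx
            have : (fderiv ℝ f x).det = 0 := hx.2
            simp [this]
        rw [this, zero_add]

/-! ### Volume-preserving orthogonal splittings -/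

/-- An orthonormal family splits a Euclidean space into its coordinates along the family and
a Euclidean complement, preserving volume. -/
theorem exists_measurePreserving_splitting {E ι : Type*} [NormedAddCommGroup E]
    [InnerProductSpace ℝ E] [FiniteDimensional ℝ E] [MeasurableSpace E] [BorelSpace E] [Fintype ι]
    {w : ι → E} (hw : Orthonormal ℝ w) {d : ℕ} (hd : Module.finrank ℝ E = Fintype.card ι + d) :
    ∃ Ψ : E ≃L[ℝ] (ι → ℝ) × EuclideanSpace ℝ (Fin d), MeasurePreserving Ψ ∧
      (∀ F i, (Ψ F).1 i = inner ℝ (w i) F) ∧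
      ∀ F, ‖F‖ ^ 2 = ∑ i, (Ψ F).1 i ^ 2 + ‖(Ψ F).2‖ ^ 2 := by
  have hcard : Module.finrank ℝ E = Fintype.card (ι ⊕ Fin d) := by simp [hd]
  have hv : Orthonormal ℝ ((range Sum.inl).domRestrict (Sum.elim w (0 : Fin d → E))) := by
    have : (range (Sum.inl : ι → ι ⊕ Fin d)).domRestrict (Sum.elim w (0 : Fin d → E))
        = w ∘ (Equiv.ofInjective (Sum.inl : ι → ι ⊕ Fin d) Sum.inl_injective).symm := by
      ext ⟨_, i, rfl⟩
      simp
    rw [this]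
    exact hw.comp _ (Equiv.injective _)
  obtain ⟨b, hb⟩ := hv.exists_orthonormalBasis_extension_of_card_eq hcard
  let e1 : E ≃L[ℝ] EuclideanSpace ℝ (ι ⊕ Fin d) := b.repr.toContinuousLinearEquiv
  let e2 : (EuclideanSpace ℝ (ι ⊕ Fin d)) ≃L[ℝ] (ι ⊕ Fin d → ℝ) := EuclideanSpace.equiv _ ℝ
  let e3 : (ι ⊕ Fin d → ℝ) ≃L[ℝ] (ι → ℝ) × (Fin d → ℝ) :=
    (LinearEquiv.sumArrowLequivProdArrow ι (Fin d) ℝ ℝ).toContinuousLinearEquiv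
  let e4 : ((ι → ℝ) × (Fin d → ℝ)) ≃L[ℝ] (ι → ℝ) × EuclideanSpace ℝ (Fin d) :=
    (ContinuousLinearEquiv.refl ℝ _).prodCongr (EuclideanSpace.equiv (Fin d) ℝ).symm
  refine ⟨((e1.trans e2).trans e3).trans e4, ?_, ?_, ?_⟩
  · have m1 : MeasurePreserving e1 := b.measurePreserving_repr
    have m2 : MeasurePreserving e2 := PiLp.volume_preserving_ofLp _
    have m3 : MeasurePreserving e3 := volume_measurePreserving_sumPiEquivProdPi (fun _ => ℝ)
    have m4 : MeasurePreserving e4 :=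
      (MeasurePreserving.id volume).prod (PiLp.volume_preserving_toLp (Fin d))
    exact m4.comp (m3.comp (m2.comp m1))
  · intro F i
    have h1 : b (Sum.inl i) = w i := hb _ ⟨i, rfl⟩
    rw [← h1, ← b.repr_apply_apply]
    rfl
  · intro F
    rw [← b.repr.norm_map, EuclideanSpace.norm_sq_eq, EuclideanSpace.norm_sq_eq,
      Fintype.sum_sum_type]
    simp only [Real.norm_eq_abs, sq_abs]
    rfl

/-- `exists_measurePreserving_splitting` for two vectors. -/
theorem exists_measurePreserving_splitting_two {E : Type*} [NormedAddCommGroup E]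
    [InnerProductSpace ℝ E] [FiniteDimensional ℝ E] [MeasurableSpace E] [BorelSpace E]
    {w : Fin 2 → E} (hw : Orthonormal ℝ w) {d : ℕ} (hd : Module.finrank ℝ E = 2 + d) :
    ∃ Ψ : E ≃L[ℝ] (ℝ × ℝ) × EuclideanSpace ℝ (Fin d), MeasurePreserving Ψ ∧
      (∀ F, (Ψ F).1 = (inner ℝ (w 0) F, inner ℝ (w 1) F)) ∧
      ∀ F, ‖F‖ ^ 2 = (Ψ F).1.1 ^ 2 + (Ψ F).1.2 ^ 2 + ‖(Ψ F).2‖ ^ 2 := by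
  obtain ⟨Ψ, h1, h2, h3⟩ := exists_measurePreserving_splitting hw (d := d) (by simp [hd])
  let e : (Fin 2 → ℝ) ≃L[ℝ] ℝ × ℝ := ContinuousLinearEquiv.finTwoArrow ℝ ℝ
  refine ⟨Ψ.trans (e.prodCongr (ContinuousLinearEquiv.refl ℝ _)), ?_, ?_, ?_⟩
  · have m : MeasurePreserving e := volume_preserving_finTwoArrow ℝ
    exact (m.prod (MeasurePreserving.id volume)).comp h1
  · intro F
    have : ((Ψ.trans (e.prodCongr (ContinuousLinearEquiv.refl ℝ _))) F).1
      = ((Ψ F).1 0, (Ψ F).1 1) := rfl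
    rw [this, h2, h2]
  · intro F
    rw [h3, Fin.sum_univ_two]
    rfl

/-- `exists_measurePreserving_splitting` for two pairs of vectors. -/
theorem exists_measurePreserving_splitting_four {E : Type*} [NormedAddCommGroup E]
    [InnerProductSpace ℝ E] [FiniteDimensional ℝ E] [MeasurableSpace E] [BorelSpace E]
    {u v : Fin 2 → E} (hw : Orthonormal ℝ (Sum.elim u v)) {d : ℕ}
    (hd : Module.finrank ℝ E = 4 + d) :
    ∃ Ψ : E ≃L[ℝ] ((ℝ × ℝ) × (ℝ × ℝ)) × EuclideanSpace ℝ (Fin d), MeasurePreserving Ψ ∧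
      (∀ F, (Ψ F).1 = ((inner ℝ (u 0) F, inner ℝ (u 1) F), (inner ℝ (v 0) F, inner ℝ (v 1) F))) ∧
      ∀ F, ‖F‖ ^ 2 = (Ψ F).1.1.1 ^ 2 + (Ψ F).1.1.2 ^ 2 + (Ψ F).1.2.1 ^ 2 + (Ψ F).1.2.2 ^ 2
        + ‖(Ψ F).2‖ ^ 2 := by
  obtain ⟨Ψ, h1, h2, h3⟩ := exists_measurePreserving_splitting hw (d := d) (by simp [hd])
  let e : (Fin 2 → ℝ) ≃L[ℝ] ℝ × ℝ := ContinuousLinearEquiv.finTwoArrow ℝ ℝ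
  let e' : (Fin 2 ⊕ Fin 2 → ℝ) ≃L[ℝ] (Fin 2 → ℝ) × (Fin 2 → ℝ) :=
    (LinearEquiv.sumArrowLequivProdArrow (Fin 2) (Fin 2) ℝ ℝ).toContinuousLinearEquiv
  refine ⟨Ψ.trans ((e'.trans (e.prodCongr e)).prodCongr (ContinuousLinearEquiv.refl ℝ _)),
    ?_, ?_, ?_⟩
  · have m : MeasurePreserving e := volume_preserving_finTwoArrow ℝ
    have m' : MeasurePreserving e' := volume_measurePreserving_sumPiEquivProdPi (fun _ => ℝ)
    exact (((m.prod m).comp m').prod (MeasurePreserving.id volume)).comp h1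
  · intro F
    have : ((Ψ.trans ((e'.trans (e.prodCongr e)).prodCongr (ContinuousLinearEquiv.refl ℝ _))) F).1
      = (((Ψ F).1 (.inl 0), (Ψ F).1 (.inl 1)), ((Ψ F).1 (.inr 0), (Ψ F).1 (.inr 1))) := rfl
    rw [this, h2, h2, h2, h2]
    rfl
  · intro F
    rw [h3, Fintype.sum_sum_type, Fin.sum_univ_two, Fin.sum_univ_two, ← add_assoc]
    rfl

/-! ### Triple coincidences form a null set -/

/-- A differentiable self-map that is constant along a direction has null image. -/
theorem measure_image_eq_zero_of_invariant {E : Type*} [NormedAddCommGroup E] [NormedSpace ℝ E]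
    [FiniteDimensional ℝ E] [MeasurableSpace E] [BorelSpace E] (μ : Measure E)
    [μ.IsAddHaarMeasure] {f : E → E} {s : Set E} (hf : ∀ x ∈ s, DifferentiableAt ℝ f x) {e : E}
    (he : e ≠ 0) (hinv : ∀ x (t : ℝ), f (x + t • e) = f x) : μ (f '' s) = 0 := by
  refine addHaar_image_eq_zero_of_det_fderivWithin_eq_zero μ
    (fun x hx => (hf x hx).hasFDerivAt.hasFDerivWithinAt) fun x hx => ?_
  by_contra hdet
  -- The direction `e` lies in the kernel of the derivative, which contradicts a nonzero
  -- determinant.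
  have h1 : HasLineDerivAt ℝ f (fderiv ℝ f x e) x e := (hf x hx).hasFDerivAt.hasLineDerivAt e
  have h2 : fderiv ℝ f x e = 0 := by
    unfold HasLineDerivAt at h1
    simp_rw [hinv] at h1
    exact h1.unique (hasDerivAt_const _ _)
  have h3 : ((fderiv ℝ f x).toContinuousLinearEquivOfDetNeZero hdet) e = 0 := h2
  exact he ((ContinuousLinearEquiv.map_eq_zero_iff _).1 h3)

variable {N : ℕ}

/-- The component `i` of a curve without its mode `m`. -/
noncomputable def puncturedComponent (m : Mode N) (c : CurveSpace N) (i : Fin 2) (φ : ℝ) : ℝ :=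
  ∑ k ∈ Finset.univ.erase m, c (i, k) * modeFun k φ

theorem component_eq_add_puncturedComponent (m : Mode N) (c : CurveSpace N) (i : Fin 2) (φ : ℝ) :
    component c i φ = c (i, m) * modeFun m φ + puncturedComponent m c i φ := by
  rw [component_eq_sum, puncturedComponent]
  exact (Finset.add_sum_erase _ (fun k => c (i, k) * modeFun k φ) (Finset.mem_univ m)).symm

theorem puncturedComponent_congr {m : Mode N} {c d : CurveSpace N} {i : Fin 2}
    (h : ∀ k, k ≠ m → c (i, k) = d (i, k)) (φ : ℝ) :
    puncturedComponent m c i φ = puncturedComponent m d i φ :=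
  Finset.sum_congr rfl fun k hk => by rw [h k (Finset.ne_of_mem_erase hk)]

theorem differentiable_modeFun (k : Mode N) : Differentiable ℝ (modeFun k) := by
  rcases k with _ | j | j <;> (unfold modeFun; fun_prop)

theorem Differentiable.puncturedComponent {X : Type*} [NormedAddCommGroup X] [NormedSpace ℝ X]
    (m : Mode N) (i : Fin 2) {c : X → CurveSpace N} {φ : X → ℝ} (hc : Differentiable ℝ c)
    (hφ : Differentiable ℝ φ) :
    Differentiable ℝ fun x => puncturedComponent m (c x) i (φ x) := by
  unfold TrigCurve.puncturedComponent
  refine Differentiable.fun_sum fun k _ => ?_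
  have h1 : Differentiable ℝ fun x => c x (i, k) := by fun_prop
  exact h1.mul ((differentiable_modeFun k).comp hφ)

/-- The coefficients of mode `m` for which a curve passes through the same point at the parameters
`c.2 (0, 0)` and `c.2 (1, 0)`. -/
noncomputable def closingCoeff (m : Mode N) (c : CurveSpace N × CurveSpace N) (i : Fin 2) : ℝ :=
  -(puncturedComponent m c.1 i (c.2 (0, Sum.inl ())) -
    puncturedComponent m c.1 i (c.2 (1, Sum.inl ()))) /
  (modeFun m (c.2 (0, Sum.inl ())) - modeFun m (c.2 (1, Sum.inl ())))

/-- A parametrization of the pairs of curves `(f, g)` for which `g` passes through a double point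
of `f`: the constant modes of `g` and the mode `m` of `f` are replaced by the three parameters of
the triple coincidence and one idle coordinate. -/
noncomputable def tripleMap (m : Mode N) (c : CurveSpace N × CurveSpace N) :
    CurveSpace N × CurveSpace N :=
  (WithLp.toLp 2 fun q => if q.2 = m then closingCoeff m c q.1 else c.1 q,
   WithLp.toLp 2 fun q => if q.2 = Sum.inl () then
      √2 * (closingCoeff m c q.1 * modeFun m (c.2 (0, Sum.inl ()))
        + puncturedComponent m c.1 q.1 (c.2 (0, Sum.inl ()))
        - puncturedComponent (Sum.inl ()) c.2 q.1 (c.1 (0, m))) else c.2 q)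

theorem differentiableAt_closingCoeff {m : Mode N} {c : CurveSpace N × CurveSpace N}
    (h : modeFun m (c.2 (0, Sum.inl ())) ≠ modeFun m (c.2 (1, Sum.inl ()))) (i : Fin 2) :
    DifferentiableAt ℝ (fun c => closingCoeff m c i) c := by
  have h1 (j : Fin 2) : Differentiable ℝ fun c : CurveSpace N × CurveSpace N =>
      c.2 (j, Sum.inl ()) := by fun_prop
  have h2 (j : Fin 2) : Differentiable ℝ fun c : CurveSpace N × CurveSpace N =>
      puncturedComponent m c.1 i (c.2 (j, Sum.inl ())) :=
    Differentiable.puncturedComponent m i differentiable_fst (h1 j)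
  have h3 (j : Fin 2) : Differentiable ℝ fun c : CurveSpace N × CurveSpace N =>
      modeFun m (c.2 (j, Sum.inl ())) := (differentiable_modeFun m).comp (h1 j)
  unfold closingCoeff
  simp_rw [div_eq_mul_inv]
  exact ((h2 0 c).sub (h2 1 c)).neg.mul (((h3 0 c).sub (h3 1 c)).inv (sub_ne_zero.2 h))

theorem differentiableAt_tripleMap {m : Mode N} {c : CurveSpace N × CurveSpace N}
    (h : modeFun m (c.2 (0, Sum.inl ())) ≠ modeFun m (c.2 (1, Sum.inl ()))) :
    DifferentiableAt ℝ (tripleMap m) c := by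
  have h1 (j : Fin 2) : Differentiable ℝ fun c : CurveSpace N × CurveSpace N =>
      c.2 (j, Sum.inl ()) := by fun_prop
  have h2 : Differentiable ℝ fun c : CurveSpace N × CurveSpace N => c.1 (0, m) := by fun_prop
  refine DifferentiableAt.prodMk ?_ ?_
  · refine differentiableAt_euclidean.2 fun q => ?_
    by_cases hq : q.2 = m
    · simp only [hq, if_true]
      exact differentiableAt_closingCoeff h q.1
    · simp only [hq, if_false]
      fun_prop
  · refine differentiableAt_euclidean.2 fun q => ?_
    by_cases hq : q.2 = Sum.inl ()
    · simp only [hq, if_true]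
      exact ((((differentiableAt_closingCoeff h q.1).mul
        (((differentiable_modeFun m).comp (h1 0)) c)).add
        (Differentiable.puncturedComponent m q.1 differentiable_fst (h1 0) c)).sub
        (Differentiable.puncturedComponent (Sum.inl ()) q.1 differentiable_snd h2 c)).const_mul _
    · simp only [hq, if_false]
      fun_prop

/-- Four coefficients are determined by the coincidence and free four slots. The parameters `φ₁`,
`φ₂`, `ψ` fill only three of them; the slot `(1, m)` of the first curve is the idle one. -/
theorem tripleMap_add_smul {m : Mode N} (c : CurveSpace N × CurveSpace N) (t : ℝ) :
    tripleMap m (c + t • (EuclideanSpace.single (1, m) 1, 0)) = tripleMap m c := by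
  set c' := c + t • ((EuclideanSpace.single (1, m) 1, 0) : CurveSpace N × CurveSpace N)
  have h2 : c'.2 = c.2 := by simp [c']
  have h1 : ∀ q, q ≠ (1, m) → c'.1 q = c.1 q := by
    intro q hq
    simp [c', hq]
  have hp : ∀ i φ, puncturedComponent m c'.1 i φ = puncturedComponent m c.1 i φ := by
    intro i φ
    refine puncturedComponent_congr (fun k hk => h1 _ ?_) φ
    exact fun h => hk (congrArg Prod.snd h)
  have hc : ∀ i, closingCoeff m c' i = closingCoeff m c i := by
    intro i
    simp only [closingCoeff, hp, h2]
  have h0 : c'.1 (0, m) = c.1 (0, m) := h1 _ (by simp)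
  unfold tripleMap
  refine Prod.ext ?_ ?_
  · ext q
    by_cases hq : q.2 = m
    · simp [hq, hc]
    · simp only [hq, if_false]
      exact h1 q fun h => hq (congrArg Prod.snd h)
  · ext q
    simp [hc, hp, h2, h0]

/-- The double point is a linear equation, in each component, for the coefficient of mode `m` of the
first curve, solvable when that mode separates `φ₁` from `φ₂`. Passing through the point is then a
linear equation for the constant mode of the second curve. -/
theorem exists_tripleMap_eq {m : Mode N} {p : CurveSpace N × CurveSpace N}
    {φ₁ φ₂ ψ : ℝ} (hφ : modeFun m φ₁ ≠ modeFun m φ₂)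
    (h : ∀ i, component p.1 i φ₁ = component p.1 i φ₂)
    (h' : ∀ i, component p.1 i φ₁ = component p.2 i ψ) :
    ∃ c : CurveSpace N × CurveSpace N,
      modeFun m (c.2 (0, Sum.inl ())) ≠ modeFun m (c.2 (1, Sum.inl ())) ∧ tripleMap m c = p := by
  set c : CurveSpace N × CurveSpace N :=
    (WithLp.toLp 2 fun q => if q.2 = m then ψ else p.1 q,
     WithLp.toLp 2 fun q => if q.2 = Sum.inl () then (if q.1 = 0 then φ₁ else φ₂) else p.2 q)
  have hc0 : c.2 (0, Sum.inl ()) = φ₁ := by simp [c]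
  have hc1 : c.2 (1, Sum.inl ()) = φ₂ := by simp [c]
  have hcm : c.1 (0, m) = ψ := by simp [c]
  have hp1 (i φ) : puncturedComponent m c.1 i φ = puncturedComponent m p.1 i φ :=
    puncturedComponent_congr (fun k hk => by simp [c, hk]) φ
  have hp2 (i φ) : puncturedComponent (Sum.inl ()) c.2 i φ
      = puncturedComponent (Sum.inl ()) p.2 i φ :=
    puncturedComponent_congr (fun k hk => by simp [c, hk]) φ
  have hcl (i) : closingCoeff m c i = p.1 (i, m) := by
    rw [closingCoeff, hp1, hp1, hc0, hc1, div_eq_iff (sub_ne_zero.2 hφ)]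
    have := h i
    rw [component_eq_add_puncturedComponent m, component_eq_add_puncturedComponent m] at this
    linarith
  refine ⟨c, by rwa [hc0, hc1], Prod.ext ?_ ?_⟩
  · ext ⟨i, k⟩
    by_cases hk : k = m
    · simp [tripleMap, hk, hcl]
    · simp [tripleMap, hk, c]
  · ext ⟨i, k⟩
    by_cases hk : k = Sum.inl ()
    · have := h' i
      rw [component_eq_add_puncturedComponent m,
        component_eq_add_puncturedComponent (Sum.inl ()) p.2] at this
      simp only [tripleMap, hk, hcl, hc0, hp1, hp2, hcm, this, if_true, add_sub_cancel_right]
      simp only [modeFun]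
      field_simp
    · simp [tripleMap, hk, c]

/-- The pairs of curves such that the second passes through a double point of the first. -/
def tripleSet (N : ℕ) : Set (CurveSpace N × CurveSpace N) :=
  {p | ∃ φ₁ φ₂ ψ : ℝ, (Real.cos φ₁ ≠ Real.cos φ₂ ∨ Real.sin φ₁ ≠ Real.sin φ₂) ∧
    (∀ i, component p.1 i φ₁ = component p.1 i φ₂) ∧ ∀ i, component p.1 i φ₁ = component p.2 i ψ}

/-- Distinct points of the circle are separated by `cos` or by `sin`, so the two charts `tripleMap
m` with `m` a mode of degree one cover the set. -/
theorem volume_tripleSet (hN : 0 < N) : volume (tripleSet N) = 0 := by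
  have : ((volume : Measure (CurveSpace N)).prod
      (volume : Measure (CurveSpace N))).IsAddHaarMeasure := Measure.prod.instIsAddHaarMeasure _ _
  have key : ∀ m : Mode N, volume (tripleMap m ''
      {c | modeFun m (c.2 (0, Sum.inl ())) ≠ modeFun m (c.2 (1, Sum.inl ()))}) = 0 := fun m =>
    measure_image_eq_zero_of_invariant (volume.prod volume)
      (fun c hc => differentiableAt_tripleMap hc)
      (e := (EuclideanSpace.single (1, m) 1, 0)) (by simp [Prod.ext_iff]) tripleMap_add_smul
  refine measure_mono_null ?_ (measure_union_null (key (Sum.inr (Sum.inl ⟨0, hN⟩)))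
    (key (Sum.inr (Sum.inr ⟨0, hN⟩))))
  rintro p ⟨φ₁, φ₂, ψ, h0 | h0, h, h'⟩
  · left
    obtain ⟨c, h1, h2⟩ := exists_tripleMap_eq (m := Sum.inr (Sum.inl ⟨0, hN⟩))
      (by simpa [modeFun] using h0) h h'
    exact ⟨c, h1, h2⟩
  · right
    obtain ⟨c, h1, h2⟩ := exists_tripleMap_eq (m := Sum.inr (Sum.inr ⟨0, hN⟩))
      (by simpa [modeFun] using h0) h h'
    exact ⟨c, h1, h2⟩

/-! ### From intersection points to pairs of parameters -/

/-- The point of a curve at a parameter, as a pair of real numbers. -/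
noncomputable def point (c : CurveSpace N) (φ : ℝ) : ℝ × ℝ := (component c 0 φ, component c 1 φ)

theorem component_eq_of_point_eq {c d : CurveSpace N} {φ ψ : ℝ} (h : point c φ = point d ψ)
    (i : Fin 2) : component c i φ = component d i ψ := by
  simp only [point, Prod.mk.injEq] at h
  fin_cases i
  exacts [h.1, h.2]

theorem curve_eq_curve_iff {c d : CurveSpace N} {φ ψ : ℝ} :
    curve c φ = curve d ψ ↔ point c φ = point d ψ := by
  constructor
  · intro h
    have h0 := congrArg (fun v : EuclideanSpace ℝ (Fin 2) => v 0) h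
    have h1 := congrArg (fun v : EuclideanSpace ℝ (Fin 2) => v 1) h
    exact Prod.ext h0 h1
  · intro h
    simp only [point, Prod.mk.injEq] at h
    simp [curve, h.1, h.2]

theorem periodic_modeFun (k : Mode N) : Function.Periodic (modeFun k) (2 * Real.pi) := by
  have e (j : Fin N) (φ : ℝ) : ((j : ℕ) + 1 : ℝ) * (φ + 2 * Real.pi)
      = ((j : ℕ) + 1 : ℝ) * φ + ((j + 1 : ℕ) : ℝ) * (2 * Real.pi) := by push_cast; ring
  intro φ
  rcases k with _ | j | j
  · rfl
  · simp only [modeFun]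
    rw [e, Real.cos_add_nat_mul_two_pi]
  · simp only [modeFun]
    rw [e, Real.sin_add_nat_mul_two_pi]

theorem periodic_curve (c : CurveSpace N) : Function.Periodic (curve c) (2 * Real.pi) := by
  intro φ
  rw [curve_eq_curve_iff]
  simp only [point, component_eq_sum, (periodic_modeFun _) φ]

/-- The parameter pairs, in one period, at which two curves meet. -/
def meetingParams (p : CurveSpace N × CurveSpace N) : Set (ℝ × ℝ) :=
  (Ico 0 (2 * Real.pi) ×ˢ Ico 0 (2 * Real.pi)) ∩ {t | point p.1 t.1 = point p.2 t.2}

theorem cos_ne_or_sin_ne {φ₁ φ₂ : ℝ} (h₁ : φ₁ ∈ Ico 0 (2 * Real.pi))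
    (h₂ : φ₂ ∈ Ico 0 (2 * Real.pi)) (h : φ₁ ≠ φ₂) :
    Real.cos φ₁ ≠ Real.cos φ₂ ∨ Real.sin φ₁ ≠ Real.sin φ₂ := by
  by_contra! hcs
  have hang : (φ₁ : Real.Angle) = φ₂ := Real.Angle.cos_sin_inj hcs.1 hcs.2
  obtain ⟨k, hk⟩ := Real.Angle.angle_eq_iff_two_pi_dvd_sub.1 hang
  have hpi := Real.pi_pos
  have h1 : (k : ℝ) < 1 := by
    by_contra! hh
    nlinarith [h₁.1, h₁.2, h₂.1, h₂.2]
  have h2 : (-1 : ℝ) < k := by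
    by_contra! hh
    nlinarith [h₁.1, h₁.2, h₂.1, h₂.2]
  have h3 : k = 0 := by
    have h1' : k < 1 := by exact_mod_cast h1
    have h2' : -1 < k := by exact_mod_cast h2
    omega
  rw [h3] at hk
  apply h
  simp at hk
  linarith

/-- If two distinct parameter pairs give the same point, then they differ in the parameter of one of
the curves. That curve has a double point there, and the other passes through it, so the pair or its
swap lies in `tripleSet N`. -/
theorem ae_intersectionNumber_eq (hN : 0 < N) :
    ∀ᵐ p : CurveSpace N × CurveSpace N, intersectionNumber p = (meetingParams p).encard := by
  have h1 : ∀ᵐ p : CurveSpace N × CurveSpace N, p ∉ tripleSet N :=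
    compl_mem_ae_iff.2 (volume_tripleSet hN)
  have h2 : ∀ᵐ p : CurveSpace N × CurveSpace N, p.swap ∉ tripleSet N :=
    (Measure.measurePreserving_swap (μ := (volume : Measure (CurveSpace N)))
      (ν := (volume : Measure (CurveSpace N)))).quasiMeasurePreserving.ae h1
  filter_upwards [h1, h2] with p hp1 hp2
  have himg : range (curve p.1) ∩ range (curve p.2)
      = (fun t : ℝ × ℝ => curve p.1 t.1) '' meetingParams p := by
    ext y
    constructor
    · rintro ⟨⟨φ, rfl⟩, ⟨ψ, hψ⟩⟩
      obtain ⟨φ', hφ', e1⟩ := (periodic_curve p.1).exists_mem_Ico₀ Real.two_pi_pos φ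
      obtain ⟨ψ', hψ', e2⟩ := (periodic_curve p.2).exists_mem_Ico₀ Real.two_pi_pos ψ
      refine ⟨(φ', ψ'), ⟨⟨hφ', hψ'⟩, curve_eq_curve_iff.1 ?_⟩, e1.symm⟩
      exact e1.symm.trans (hψ.symm.trans e2)
    · rintro ⟨t, ⟨-, ht⟩, rfl⟩
      exact ⟨⟨_, rfl⟩, ⟨t.2, (curve_eq_curve_iff.2 ht).symm⟩⟩
  rw [intersectionNumber, himg, InjOn.encard_image]
  rintro ⟨φ₁, ψ₁⟩ ⟨⟨a1, b1⟩, e1⟩ ⟨φ₂, ψ₂⟩ ⟨⟨a2, b2⟩, e2⟩ h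
  simp only [mem_ofPred_eq] at e1 e2 h a1 a2 b1 b2
  have h' := curve_eq_curve_iff.1 h
  by_contra hne
  by_cases hφ : φ₁ = φ₂
  · have hψ : ψ₁ ≠ ψ₂ := fun hψ => hne (by rw [hφ, hψ])
    exact hp2 ⟨ψ₁, ψ₂, φ₁, cos_ne_or_sin_ne b1 b2 hψ,
      component_eq_of_point_eq (e1.symm.trans (h'.trans e2)), component_eq_of_point_eq e1.symm⟩
  · exact hp1 ⟨φ₁, φ₂, ψ₁, cos_ne_or_sin_ne a1 a2 hφ,
      component_eq_of_point_eq h', component_eq_of_point_eq e1⟩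

/-! ### Joint law of position and velocity -/

/-- The derivatives of the trigonometric functions `modeFun`. -/
noncomputable def modeDeriv : Mode N → ℝ → ℝ
  | Sum.inl _, _ => 0
  | Sum.inr (Sum.inl j), φ => -(((j : ℕ) + 1 : ℝ) * Real.sin (((j : ℕ) + 1 : ℝ) * φ))
  | Sum.inr (Sum.inr j), φ => ((j : ℕ) + 1 : ℝ) * Real.cos (((j : ℕ) + 1 : ℝ) * φ)

theorem hasDerivAt_modeFun (k : Mode N) (φ : ℝ) :
    HasDerivAt (modeFun k) (modeDeriv k φ) φ := by
  have h (j : Fin N) : HasDerivAt (fun φ : ℝ => ((j : ℕ) + 1 : ℝ) * φ) ((j : ℕ) + 1 : ℝ) φ := by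
    simpa using (hasDerivAt_id φ).const_mul ((j : ℕ) + 1 : ℝ)
  rcases k with _ | j | j
  · exact hasDerivAt_const _ _
  · convert! (h j).cos using 1
    simp only [modeDeriv]; ring
  · convert! (h j).sin using 1
    simp only [modeDeriv]; ring

theorem continuous_modeDeriv (k : Mode N) : Continuous (modeDeriv k) := by
  rcases k with _ | j | j <;> (unfold modeDeriv; fun_prop)

/-- The velocity of a curve. -/
noncomputable def velocity (c : CurveSpace N) (φ : ℝ) : ℝ × ℝ :=
  (∑ k, c (0, k) * modeDeriv k φ, ∑ k, c (1, k) * modeDeriv k φ)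

theorem point_eq_sum (c : CurveSpace N) (φ : ℝ) :
    point c φ = (∑ k, c (0, k) * modeFun k φ, ∑ k, c (1, k) * modeFun k φ) := by
  simp [point, component_eq_sum]

theorem hasDerivAt_point (c : CurveSpace N) (φ : ℝ) :
    HasDerivAt (point c) (velocity c φ) φ := by
  simp_rw [funext (point_eq_sum c)]
  exact (HasDerivAt.fun_sum fun k _ => (hasDerivAt_modeFun k φ).const_mul _).prodMk
    (HasDerivAt.fun_sum fun k _ => (hasDerivAt_modeFun k φ).const_mul _)

theorem continuous_point_uncurry : Continuous fun q : CurveSpace N × ℝ => point q.1 q.2 :=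
  (continuous_component_uncurry 0).prodMk (continuous_component_uncurry 1)

theorem continuous_velocity_uncurry :
    Continuous fun q : CurveSpace N × ℝ => velocity q.1 q.2 := by
  have (i : Fin 2) : Continuous fun q : CurveSpace N × ℝ =>
      ∑ k, q.1 (i, k) * modeDeriv k q.2 := by
    refine continuous_finsetSum _ fun k _ => ?_
    have h1 : Continuous fun q : CurveSpace N × ℝ => q.1 (i, k) := by fun_prop
    exact h1.mul ((continuous_modeDeriv k).comp continuous_snd)
  exact (this 0).prodMk (this 1)

theorem sum_modeFun_sq (φ : ℝ) :
    ∑ k : Mode N, modeFun k φ * modeFun k φ = (2 * N + 1) / 2 := by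
  have h : (√2)⁻¹ * (√2)⁻¹ = (1 / 2 : ℝ) := by
    rw [← mul_inv, Real.mul_self_sqrt (by norm_num)]; norm_num
  simp only [Fintype.sum_sum_type, modeFun, Finset.univ_unique, Finset.sum_singleton, one_div, h]
  rw [← Finset.sum_add_distrib]
  simp only [← sq, Real.cos_sq_add_sin_sq]
  simp
  ring

theorem sum_modeFun_mul_modeDeriv (φ : ℝ) :
    ∑ k : Mode N, modeFun k φ * modeDeriv k φ = 0 := by
  simp only [Fintype.sum_sum_type, modeFun, modeDeriv, mul_zero, Finset.sum_const_zero, zero_add]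
  rw [← Finset.sum_add_distrib]
  exact Finset.sum_eq_zero fun j _ => by ring

theorem sum_modeDeriv_sq (φ : ℝ) :
    ∑ k : Mode N, modeDeriv k φ * modeDeriv k φ = N * (N + 1) * (2 * N + 1) / 6 := by
  simp only [Fintype.sum_sum_type, modeDeriv, mul_zero, Finset.sum_const_zero, zero_add]
  rw [← Finset.sum_add_distrib]
  have : ∀ j : Fin N, -(((j : ℕ) + 1 : ℝ) * Real.sin (((j : ℕ) + 1 : ℝ) * φ)) *
      -(((j : ℕ) + 1 : ℝ) * Real.sin (((j : ℕ) + 1 : ℝ) * φ)) +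
      ((j : ℕ) + 1 : ℝ) * Real.cos (((j : ℕ) + 1 : ℝ) * φ) *
      (((j : ℕ) + 1 : ℝ) * Real.cos (((j : ℕ) + 1 : ℝ) * φ)) = ((j : ℕ) + 1 : ℝ) ^ 2 := by
    intro j
    linear_combination ((j : ℕ) + 1 : ℝ) ^ 2 *
      Real.sin_sq_add_cos_sq (((j : ℕ) + 1 : ℝ) * φ)
  rw [Finset.sum_congr rfl fun j _ => this j, Fin.sum_univ_eq_sum_range fun j => ((j : ℝ) + 1) ^ 2]
  induction N with
  | zero => simp
  | succ n ih =>
    have h0 := ih (fun j => by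
      linear_combination ((j : ℕ) + 1 : ℝ) ^ 2 *
        Real.sin_sq_add_cos_sq (((j : ℕ) + 1 : ℝ) * φ))
    rw [Finset.sum_range_succ, h0]
    push_cast
    ring

/-- The curve whose component `i` has coefficients `a` and whose other component vanishes. -/
noncomputable def rowVector (i : Fin 2) (a : Mode N → ℝ) : CurveSpace N :=
  WithLp.toLp 2 fun q => if q.1 = i then a q.2 else 0

theorem inner_rowVector (i : Fin 2) (a : Mode N → ℝ) (c : CurveSpace N) :
    inner ℝ (rowVector i a) c = ∑ k, c (i, k) * a k := by
  simp only [PiLp.inner_apply, rowVector, Fintype.sum_prod_type, RCLike.inner_apply, conj_trivial,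
    mul_ite, mul_zero]
  rw [Finset.sum_eq_single i]
  · simp
  · intro j _ hj
    simp [hj]
  · simp

theorem inner_rowVector_rowVector (i j : Fin 2) (a b : Mode N → ℝ) :
    inner ℝ (rowVector i a) (rowVector j b) = if i = j then ∑ k, b k * a k else 0 := by
  rw [inner_rowVector]
  by_cases h : i = j <;> simp [rowVector, h]

/-- The norm of the vector of the trigonometric functions at a point. -/
noncomputable def pointScale (N : ℕ) : ℝ := √((2 * N + 1) / 2)

/-- The norm of the vector of the derivatives of the trigonometric functions at a point. -/
noncomputable def velocityScale (N : ℕ) : ℝ := √(N * (N + 1) * (2 * N + 1) / 6)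

theorem pointScale_pos : 0 < pointScale N := Real.sqrt_pos.2 (by positivity)

theorem velocityScale_pos (hN : 0 < N) : 0 < velocityScale N := by
  have : (0 : ℝ) < N := by exact_mod_cast hN
  exact Real.sqrt_pos.2 (by positivity)

/-- These vectors represent the normalized position and velocity functionals at `φ`. Sine and cosine
of equal degree have squares adding up to 1, so the norms do not depend on `φ`; the mixed products
cancel in each degree, which makes velocity orthogonal to position. -/
theorem orthonormal_rowVectors (hN : 0 < N) (φ : ℝ) : Orthonormal ℝ (Sum.elim
    (fun i : Fin 2 => rowVector i fun k : Mode N => (pointScale N)⁻¹ * modeFun k φ)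
    (fun i : Fin 2 => rowVector i fun k : Mode N => (velocityScale N)⁻¹ * modeDeriv k φ)) := by
  have hp : pointScale N * pointScale N = (2 * N + 1) / 2 := Real.mul_self_sqrt (by positivity)
  have hv : velocityScale N * velocityScale N = N * (N + 1) * (2 * N + 1) / 6 :=
    Real.mul_self_sqrt (by positivity)
  have hp0 := (pointScale_pos (N := N)).ne'
  have hv0 := (velocityScale_pos hN).ne'
  rw [orthonormal_iff_ite]
  have hs : ∑ k : Mode N, modeDeriv k φ * modeFun k φ = 0 := by
    simp_rw [mul_comm (modeDeriv _ _)]; exact sum_modeFun_mul_modeDeriv φ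
  have hscale (α β : ℝ) (a b : Mode N → ℝ) :
      ∑ k, α * b k * (β * a k) = α * β * ∑ k, b k * a k := by
    rw [Finset.mul_sum]
    exact Finset.sum_congr rfl fun k _ => by ring
  rintro (i | i) (j | j) <;>
    simp only [Sum.elim_inl, Sum.elim_inr, inner_rowVector_rowVector, hscale, sum_modeFun_sq,
      sum_modeDeriv_sq, sum_modeFun_mul_modeDeriv, hs, mul_zero, Sum.inl.injEq, Sum.inr.injEq,
      reduceCtorEq, ite_self, if_false]
  · rw [← hp]; congr 1; field_simp
  · rw [← hv]; congr 1; field_simp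

/-- For negative `T` the set is empty, and `0 ^ k = 0` because `k` is positive; the truncation lets
one formula serve for all `T`. -/
theorem volume_norm_sq_le {k : ℕ} (hk : 0 < k) (T : ℝ) :
    volume {w : EuclideanSpace ℝ (Fin (2 * k)) | ‖w‖ ^ 2 ≤ T}
      = ENNReal.ofReal (Real.pi ^ k / (k.factorial : ℝ) * (max T 0) ^ k) := by
  rcases lt_or_ge T 0 with hT | hT
  · have : {w : EuclideanSpace ℝ (Fin (2 * k)) | ‖w‖ ^ 2 ≤ T} = ∅ := by
      ext w
      simp only [mem_ofPred_eq, mem_empty_iff_false, iff_false, not_le]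
      exact hT.trans_le (by positivity)
    rw [this, max_eq_right hT.le, zero_pow hk.ne']
    simp
  · have hset : {w : EuclideanSpace ℝ (Fin (2 * k)) | ‖w‖ ^ 2 ≤ T} = Metric.closedBall 0 (√T) := by
      ext w
      simp only [mem_ofPred_eq, mem_closedBall_zero_iff]
      exact (Real.le_sqrt (norm_nonneg _) hT).symm
    have : Nonempty (Fin (2 * k)) := ⟨⟨0, by omega⟩⟩
    have hfr : Module.finrank ℝ (EuclideanSpace ℝ (Fin (2 * k))) = 2 * k := by simp
    rw [hset, InnerProductSpace.volume_closedBall_of_dim_even hfr, hfr,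
      max_eq_left hT, ← ENNReal.ofReal_pow (Real.sqrt_nonneg _),
      ← ENNReal.ofReal_mul (by positivity), pow_mul, Real.sq_sqrt hT, mul_comm]

/-- The density of the marginal of the volume of a ball of radius `R` in dimension `4 N + 2` on
four of the coordinates. -/
noncomputable def marginalDensity (N : ℕ) (R : ℝ) (x p : ℝ × ℝ) : ℝ :=
  Real.pi ^ (2 * N - 1) / ((2 * N - 1).factorial : ℝ) *
    (max (R ^ 2 - (x.1 ^ 2 + x.2 ^ 2) - (p.1 ^ 2 + p.2 ^ 2)) 0) ^ (2 * N - 1)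

theorem finrank_curveSpace : Module.finrank ℝ (CurveSpace N) = 4 * N + 2 := by
  simp; ring

/-- The joint distribution of position and velocity of a curve in a ball. -/
theorem lintegral_closedBall_point_velocity (hN : 0 < N) {R : ℝ} (hR : 0 ≤ R) (φ : ℝ)
    {a : (ℝ × ℝ) × (ℝ × ℝ) → ℝ≥0∞} (ha : Measurable a) :
    ∫⁻ F in Metric.closedBall (0 : CurveSpace N) R, a (point F φ, velocity F φ)
      = ∫⁻ x : ℝ × ℝ, ∫⁻ p : ℝ × ℝ, ENNReal.ofReal (marginalDensity N R x p) *
          a (pointScale N • x, velocityScale N • p) := by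
  have hk : 0 < 2 * N - 1 := by omega
  -- Removing four of the `4 N + 2` dimensions leaves the even number `2 (2 N - 1)`, and the slices
  -- of the ball are balls of that dimension.
  obtain ⟨Ψ, hΨ, h1, h2⟩ := exists_measurePreserving_splitting_four (orthonormal_rowVectors hN φ)
    (d := 2 * (2 * N - 1)) (by rw [finrank_curveSpace]; omega)
  have hp0 := (pointScale_pos (N := N)).ne'
  have hv0 := (velocityScale_pos hN).ne'
  have hpt (F : CurveSpace N) : point F φ = pointScale N • (Ψ F).1.1 := by
    simp only [h1, inner_rowVector, point_eq_sum, Prod.smul_mk, smul_eq_mul, Finset.mul_sum]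
    congr 1 <;> exact Finset.sum_congr rfl fun k _ => by field_simp
  have hvel (F : CurveSpace N) : velocity F φ = velocityScale N • (Ψ F).1.2 := by
    simp only [h1, inner_rowVector, velocity, Prod.smul_mk, smul_eq_mul, Finset.mul_sum]
    congr 1 <;> exact Finset.sum_congr rfl fun k _ => by field_simp
  set Q : Set (((ℝ × ℝ) × (ℝ × ℝ)) × EuclideanSpace ℝ (Fin (2 * (2 * N - 1)))) :=
    {y | ‖y.2‖ ^ 2 ≤ R ^ 2 - (y.1.1.1 ^ 2 + y.1.1.2 ^ 2) - (y.1.2.1 ^ 2 + y.1.2.2 ^ 2)} with hQ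
  have hQm : MeasurableSet Q := measurableSet_le (by fun_prop) (by fun_prop)
  have hball (F : CurveSpace N) : F ∈ Metric.closedBall (0 : CurveSpace N) R ↔ Ψ F ∈ Q := by
    rw [mem_closedBall_zero_iff, ← sq_le_sq₀ (norm_nonneg _) hR, h2]
    simp only [hQ, mem_ofPred_eq]
    constructor <;> intro h <;> linarith
  set G : ((ℝ × ℝ) × (ℝ × ℝ)) × EuclideanSpace ℝ (Fin (2 * (2 * N - 1))) → ℝ≥0∞ :=
    Q.indicator fun y => a (pointScale N • y.1.1, velocityScale N • y.1.2) with hG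
  have ha' : Measurable fun z : (ℝ × ℝ) × (ℝ × ℝ) =>
      a (pointScale N • z.1, velocityScale N • z.2) := ha.comp (by fun_prop)
  have hGm : Measurable G := (ha'.comp measurable_fst).indicator hQm
  have hdm : Measurable fun z : (ℝ × ℝ) × (ℝ × ℝ) =>
      ENNReal.ofReal (marginalDensity N R z.1 z.2) := by
    unfold marginalDensity; fun_prop
  calc ∫⁻ F in Metric.closedBall (0 : CurveSpace N) R, a (point F φ, velocity F φ)
      = ∫⁻ F, G (Ψ F) := by
        rw [← lintegral_indicator measurableSet_closedBall]
        congr 1; ext F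
        by_cases hF : F ∈ Metric.closedBall (0 : CurveSpace N) R
        · rw [indicator_of_mem hF, hG, indicator_of_mem ((hball F).1 hF), hpt, hvel]
        · rw [indicator_of_notMem hF, hG, indicator_of_notMem fun h => hF ((hball F).2 h)]
    _ = ∫⁻ y, G y := hΨ.lintegral_comp hGm
    _ = ∫⁻ z : (ℝ × ℝ) × (ℝ × ℝ), ∫⁻ w, G (z, w) := by
        rw [Measure.volume_eq_prod, lintegral_prod _ hGm.aemeasurable]
    _ = ∫⁻ z : (ℝ × ℝ) × (ℝ × ℝ), ENNReal.ofReal (marginalDensity N R z.1 z.2) *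
          a (pointScale N • z.1, velocityScale N • z.2) := by
        congr 1; ext z
        have hsec : ∀ w, G (z, w) = {w | ‖w‖ ^ 2 ≤ R ^ 2 - (z.1.1 ^ 2 + z.1.2 ^ 2) -
            (z.2.1 ^ 2 + z.2.2 ^ 2)}.indicator
              (fun _ => a (pointScale N • z.1, velocityScale N • z.2)) w := fun w => rfl
        simp_rw [hsec]
        rw [lintegral_indicator_const (measurableSet_le (by fun_prop) (by fun_prop)),
          volume_norm_sq_le hk, mul_comm]
        rfl
    _ = _ := by
        exact lintegral_prod _ (hdm.mul ha').aemeasurable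

/-! ### The Kac–Rice integral via translations -/

/-- The signed area of the parallelogram spanned by two plane vectors. -/
def cross (p q : ℝ × ℝ) : ℝ := p.1 * q.2 - p.2 * q.1

theorem continuousLinearMap_det_eq_cross (L : ℝ × ℝ →L[ℝ] ℝ × ℝ) :
    L.det = cross (L (1, 0)) (L (0, 1)) := by
  have : L.det = LinearMap.det (L : ℝ × ℝ →ₗ[ℝ] ℝ × ℝ) := rfl
  rw [this, ← LinearMap.det_toMatrix (Module.Basis.finTwoProd ℝ), Matrix.det_fin_two]
  simp [LinearMap.toMatrix_apply, cross]
  ring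

theorem point_add (c d : CurveSpace N) (φ : ℝ) : point (c + d) φ = point c φ + point d φ := by
  simp [point_eq_sum, add_mul, Finset.sum_add_distrib]

theorem velocity_add (c d : CurveSpace N) (φ : ℝ) :
    velocity (c + d) φ = velocity c φ + velocity d φ := by
  simp [velocity, add_mul, Finset.sum_add_distrib]

/-- Separation of the constant mode of a curve: the curve is the sum of a translation by `y / √2`
and a curve `c w` depending on the other coordinates. -/
theorem exists_measurePreserving_translation (N : ℕ) :
    ∃ (d : ℕ) (Φ : (ℝ × ℝ) × EuclideanSpace ℝ (Fin d) → CurveSpace N)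
      (c : EuclideanSpace ℝ (Fin d) → CurveSpace N),
      Continuous Φ ∧ Continuous c ∧ MeasurePreserving Φ ∧
      (∀ y w φ, point (Φ (y, w)) φ = (√2)⁻¹ • y + point (c w) φ) ∧
      ∀ y w φ, velocity (Φ (y, w)) φ = velocity (c w) φ := by
  set κ : Mode N → ℝ := fun k => if k = Sum.inl () then 1 else 0 with hκ
  have hon : Orthonormal ℝ (fun i : Fin 2 => rowVector i κ) := by
    rw [orthonormal_iff_ite]
    intro i j
    simp [inner_rowVector_rowVector, hκ]
  obtain ⟨Ψ, hΨ, h1, h2⟩ := exists_measurePreserving_splitting_two hon (d := 4 * N)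
    (by rw [finrank_curveSpace]; ring)
  have hsymm : MeasurePreserving Ψ.symm :=
    MeasurePreserving.symm Ψ.toHomeomorph.toMeasurableEquiv hΨ
  have hin (i : Fin 2) (F : CurveSpace N) : inner ℝ (rowVector i κ) F = F (i, Sum.inl ()) := by
    simp [inner_rowVector, hκ]
  have hconst (y : ℝ × ℝ) : Ψ.symm (y, 0) = rowVector 0 (y.1 • κ) + rowVector 1 (y.2 • κ) := by
    rw [ContinuousLinearEquiv.symm_apply_eq]
    set F : CurveSpace N := rowVector 0 (y.1 • κ) + rowVector 1 (y.2 • κ) with hF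
    have hF1 : (Ψ F).1 = y := by
      rw [h1, hin, hin, hF]
      simp [rowVector, hκ]
    have hF2 : ‖F‖ ^ 2 = y.1 ^ 2 + y.2 ^ 2 := by
      rw [EuclideanSpace.norm_sq_eq, Fintype.sum_prod_type]
      simp [hF, rowVector, hκ]
    -- The coordinates along the constant modes already account for the whole norm of `F`, so
    -- Pythagoras leaves nothing for the complement.
    have h0 : (Ψ F).2 = 0 := by
      have := h2 F
      rw [hF1, hF2] at this
      simpa using this
    exact Prod.ext hF1.symm h0.symm
  have hadd (y : ℝ × ℝ) (w : EuclideanSpace ℝ (Fin (4 * N))) :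
      Ψ.symm (y, w) = Ψ.symm (y, 0) + Ψ.symm (0, w) := by
    rw [← map_add]; simp
  refine ⟨4 * N, Ψ.symm, fun w => Ψ.symm (0, w), Ψ.symm.continuous,
    Ψ.symm.continuous.comp (by fun_prop), hsymm, fun y w φ => ?_, fun y w φ => ?_⟩
  · rw [hadd, point_add, hconst]
    congr 1
    simp [point_eq_sum, rowVector, hκ, modeFun, mul_comm, Prod.ext_iff]
  · rw [hadd, velocity_add, hconst]
    simp [velocity, rowVector, hκ, modeDeriv]

theorem contDiff_point (c : CurveSpace N) : ContDiff ℝ 1 (point c) := by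
  have h (k : Mode N) : ContDiff ℝ 1 (modeFun k) := by
    rcases k with _ | j | j <;> (unfold modeFun; fun_prop)
  have h' (i : Fin 2) : ContDiff ℝ 1 fun φ => ∑ k, c (i, k) * modeFun k φ :=
    ContDiff.sum fun k _ => contDiff_const.mul (h k)
  rw [funext (point_eq_sum c)]
  exact (h' 0).prodMk (h' 1)

/-- The difference of two curves as a map of the plane of parameters. -/
noncomputable def differenceMap (c G : CurveSpace N) (t : ℝ × ℝ) : ℝ × ℝ :=
  √2 • (point G t.2 - point c t.1)

theorem contDiff_differenceMap (c G : CurveSpace N) : ContDiff ℝ 1 (differenceMap c G) :=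
  (((contDiff_point G).comp contDiff_snd).sub ((contDiff_point c).comp contDiff_fst)).const_smul _

/-- The columns of the Jacobian are the two velocities, one negated, each scaled by `√2`. -/
theorem abs_det_fderiv_differenceMap (c G : CurveSpace N) (t : ℝ × ℝ) :
    |(fderiv ℝ (differenceMap c G) t).det| = 2 * |cross (velocity c t.1) (velocity G t.2)| := by
  have h1 : HasFDerivAt (differenceMap c G)
      (√2 • ((ContinuousLinearMap.toSpanSingleton ℝ (velocity G t.2)).comp
          (ContinuousLinearMap.snd ℝ ℝ ℝ) -
        (ContinuousLinearMap.toSpanSingleton ℝ (velocity c t.1)).comp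
          (ContinuousLinearMap.fst ℝ ℝ ℝ))) t :=
    (((hasDerivAt_point G t.2).hasFDerivAt.comp t hasFDerivAt_snd).sub
      ((hasDerivAt_point c t.1).hasFDerivAt.comp t hasFDerivAt_fst)).const_smul (√2)
  have h2 : √2 * √2 = 2 := Real.mul_self_sqrt (by norm_num)
  rw [h1.fderiv, continuousLinearMap_det_eq_cross]
  have : cross (velocity c t.1) (velocity G t.2) * (-2)
      = cross (√2 • -velocity c t.1) (√2 • velocity G t.2) := by
    simp only [cross, Prod.smul_fst, Prod.smul_snd, Prod.fst_neg, Prod.snd_neg, smul_eq_mul]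
    linear_combination -((velocity c t.1).1 * (velocity G t.2).2 -
      (velocity c t.1).2 * (velocity G t.2).1) * (-1) * h2
  have h3 : |cross (√2 • -velocity c t.1) (√2 • velocity G t.2)|
      = 2 * |cross (velocity c t.1) (velocity G t.2)| := by
    rw [← this, abs_mul, mul_comm]; norm_num
  rw [← h3]
  simp

theorem lintegral_comp_sqrt_two_smul {f : ℝ × ℝ → ℝ≥0∞} (hf : Measurable f) {A : ℝ} (hA : 0 < A)
    (b : ℝ × ℝ) :
    ∫⁻ x : ℝ × ℝ, f (√2 • (A • x - b)) = ENNReal.ofReal (2 * A ^ 2)⁻¹ * ∫⁻ y : ℝ × ℝ, f y := by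
  have h0 : √2 * A ≠ 0 := by positivity
  have h1 : ∀ x : ℝ × ℝ, √2 • (A • x - b) = (√2 * A) • x - √2 • b := fun x => by
    rw [smul_sub, smul_smul]
  have h2 : (√2 * A) ^ 2 = 2 * A ^ 2 := by rw [mul_pow, Real.sq_sqrt (by norm_num)]
  have h3 : (volume : Measure (ℝ × ℝ)).IsAddHaarMeasure := Measure.prod.instIsAddHaarMeasure _ _
  have hm : Measurable fun y : ℝ × ℝ => f (y - √2 • b) := hf.comp (by fun_prop)
  simp_rw [h1]
  rw [← lintegral_map hm (g := fun x : ℝ × ℝ => (√2 * A) • x) (by fun_prop),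
    Measure.map_addHaar_smul _ h0, lintegral_smul_measure,
    lintegral_sub_right_eq_self (μ := (volume : Measure (ℝ × ℝ))) f]
  have : Module.finrank ℝ (ℝ × ℝ) = 2 := by simp
  rw [this, h2, abs_of_pos (by positivity), smul_eq_mul]

/-- The square of parameter pairs, one period for each curve. -/
def paramSquare : Set (ℝ × ℝ) := Ico 0 (2 * Real.pi) ×ˢ Ico 0 (2 * Real.pi)

theorem measurableSet_paramSquare : MeasurableSet paramSquare :=
  measurableSet_Ico.prod measurableSet_Ico

theorem volume_paramSquare : volume paramSquare = ENNReal.ofReal (4 * Real.pi ^ 2) := by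
  rw [paramSquare, Measure.volume_eq_prod, Measure.prod_prod, Real.volume_Ico,
    ← ENNReal.ofReal_mul (by simp [Real.pi_nonneg])]
  congr 1; ring

/-- After translating by `y / √2`, the meeting condition can be solved for `y`; this brings the area
formula into play. -/
theorem inter_preimage_differenceMap {d : ℕ}
    {Φ : (ℝ × ℝ) × EuclideanSpace ℝ (Fin d) → CurveSpace N}
    {c : EuclideanSpace ℝ (Fin d) → CurveSpace N}
    (hpt : ∀ y w φ, point (Φ (y, w)) φ = (√2)⁻¹ • y + point (c w) φ) (G : CurveSpace N)
    (y : ℝ × ℝ) (w : EuclideanSpace ℝ (Fin d)) :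
    meetingParams (Φ (y, w), G) = paramSquare ∩ differenceMap (c w) G ⁻¹' {y} := by
  have h0 : √2 ≠ 0 := by positivity
  unfold meetingParams paramSquare
  congr 1
  ext t
  simp only [mem_ofPred_eq, mem_preimage, mem_singleton_iff, differenceMap, hpt]
  rw [← eq_sub_iff_add_eq, inv_smul_eq_iff₀ h0, eq_comm]

/-- Integration of the number of intersections with a fixed curve `G`, by the area formula in the
translations of the other curve. -/
theorem lintegral_intersectionNumber_mul {d : ℕ}
    {Φ : (ℝ × ℝ) × EuclideanSpace ℝ (Fin d) → CurveSpace N}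
    {c : EuclideanSpace ℝ (Fin d) → CurveSpace N} (hΦ : MeasurePreserving Φ)
    (hpt : ∀ y w φ, point (Φ (y, w)) φ = (√2)⁻¹ • y + point (c w) φ) {G : CurveSpace N}
    (hG : ∀ᵐ F, intersectionNumber (F, G) = (meetingParams (F, G)).encard)
    {b : CurveSpace N → ℝ≥0∞} (hb : Measurable b) :
    ∫⁻ F, b F * (intersectionNumber (F, G) : ℝ≥0∞) =
      ∫⁻ w, ∫⁻ t in paramSquare, ENNReal.ofReal
        (2 * |cross (velocity (c w) t.1) (velocity G t.2)|) *
          b (Φ (differenceMap (c w) G t, w)) := by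
  have hI : Measurable fun F : CurveSpace N => (intersectionNumber (F, G) : ℝ≥0∞) :=
    (measurable_from_top (f := fun n : ℕ∞ => (n : ℝ≥0∞))).comp
      (measurable_intersectionNumber.comp (by fun_prop))
  have hswap : ∀ᵐ w : EuclideanSpace ℝ (Fin d), ∀ᵐ y : ℝ × ℝ,
      intersectionNumber (Φ (y, w), G) = (meetingParams (Φ (y, w), G)).encard := by
    have h1 := hΦ.quasiMeasurePreserving.ae hG
    have h2 := (Measure.measurePreserving_swap
      (μ := (volume : Measure (EuclideanSpace ℝ (Fin d))))
      (ν := (volume : Measure (ℝ × ℝ)))).quasiMeasurePreserving.ae h1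
    exact Measure.ae_ae_of_ae_prod h2
  have h3 : (volume : Measure (ℝ × ℝ)).IsAddHaarMeasure := Measure.prod.instIsAddHaarMeasure _ _
  calc ∫⁻ F, b F * (intersectionNumber (F, G) : ℝ≥0∞)
      = ∫⁻ z, b (Φ z) * (intersectionNumber (Φ z, G) : ℝ≥0∞) :=
        (hΦ.lintegral_comp (hb.mul hI)).symm
    _ = ∫⁻ w, ∫⁻ y, b (Φ (y, w)) * (intersectionNumber (Φ (y, w), G) : ℝ≥0∞) :=
        lintegral_prod_symm' _ ((hb.mul hI).comp hΦ.measurable)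
    _ = ∫⁻ w, ∫⁻ y, ((paramSquare ∩ differenceMap (c w) G ⁻¹' {y}).encard : ℝ≥0∞) *
          b (Φ (y, w)) := by
        refine lintegral_congr_ae ?_
        filter_upwards [hswap] with w hw
        refine lintegral_congr_ae ?_
        filter_upwards [hw] with y hy
        rw [hy, inter_preimage_differenceMap hpt, mul_comm]
    _ = _ := by
        congr 1; ext w
        rw [lintegral_encard_preimage_mul volume (contDiff_differenceMap (c w) G)
          measurableSet_paramSquare (fun y => b (Φ (y, w)))
          (hb.comp (hΦ.measurable.comp (by fun_prop)))]
        simp_rw [abs_det_fderiv_differenceMap]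

theorem continuous_cross : Continuous fun z : (ℝ × ℝ) × (ℝ × ℝ) => cross z.1 z.2 := by
  unfold cross; fun_prop

theorem measurable_marginalDensity (N : ℕ) (R : ℝ) :
    Measurable fun z : (ℝ × ℝ) × (ℝ × ℝ) => marginalDensity N R z.1 z.2 := by
  unfold marginalDensity; fun_prop

theorem setLIntegral_eq_lintegral_indicator_mul {X : Type*} [MeasurableSpace X] (μ : Measure X)
    {s : Set X} (hs : MeasurableSet s) (f : X → ℝ≥0∞) :
    ∫⁻ x in s, f x ∂μ = ∫⁻ x, s.indicator 1 x * f x ∂μ := by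
  rw [← lintegral_indicator hs]
  congr 1; ext x
  by_cases h : x ∈ s <;> simp [h]

/-- Integration over all pairs of curves that meet at the parameters `t`. -/
theorem lintegral_translation_lintegral {d : ℕ}
    {Φ : (ℝ × ℝ) × EuclideanSpace ℝ (Fin d) → CurveSpace N}
    {c : EuclideanSpace ℝ (Fin d) → CurveSpace N} (hΦc : Continuous Φ) (hc : Continuous c)
    (hΦ : MeasurePreserving Φ)
    (hpt : ∀ y w φ, point (Φ (y, w)) φ = (√2)⁻¹ • y + point (c w) φ)
    (hvel : ∀ y w φ, velocity (Φ (y, w)) φ = velocity (c w) φ) (hN : 0 < N) {R : ℝ} (hR : 0 ≤ R)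
    (t : ℝ × ℝ) :
    ∫⁻ w, ∫⁻ G in Metric.closedBall (0 : CurveSpace N) R, ENNReal.ofReal
        (2 * |cross (velocity (c w) t.1) (velocity G t.2)|) *
          (Metric.closedBall (0 : CurveSpace N) R).indicator 1 (Φ (differenceMap (c w) G t, w))
      = ENNReal.ofReal (2 * pointScale N ^ 2)⁻¹ * ∫⁻ q : ℝ × ℝ, ∫⁻ x : ℝ × ℝ, ∫⁻ p : ℝ × ℝ,
          ENNReal.ofReal (marginalDensity N R x p) * (ENNReal.ofReal (marginalDensity N R x q) *
            ENNReal.ofReal (2 * |cross (velocityScale N • p) (velocityScale N • q)|)) := by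
  set A := pointScale N with hA
  set B := velocityScale N with hB
  have hA0 : 0 < A := pointScale_pos
  set b : CurveSpace N → ℝ≥0∞ := (Metric.closedBall (0 : CurveSpace N) R).indicator 1 with hb
  have hbm : Measurable b := measurable_one.indicator measurableSet_closedBall
  have hcp : Continuous fun w => point (c w) t.1 :=
    continuous_point_uncurry.comp (f := fun w => (c w, t.1)) (by fun_prop)
  have hcv : Continuous fun w => velocity (c w) t.1 :=
    continuous_velocity_uncurry.comp (f := fun w => (c w, t.1)) (by fun_prop)
  -- the integrand after integration over the second curve
  set k : (EuclideanSpace ℝ (Fin d) × (ℝ × ℝ)) × (ℝ × ℝ) → ℝ≥0∞ := fun z =>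
    ENNReal.ofReal (marginalDensity N R z.1.2 z.2) *
      (ENNReal.ofReal (2 * |cross (velocity (c z.1.1) t.1) (B • z.2)|) *
        b (Φ (√2 • (A • z.1.2 - point (c z.1.1) t.1), z.1.1))) with hk
  have hkm : Measurable k := by
    have c1 : Continuous fun z : (EuclideanSpace ℝ (Fin d) × (ℝ × ℝ)) × (ℝ × ℝ) =>
        velocity (c z.1.1) t.1 := hcv.comp (by fun_prop)
    have c2 : Continuous fun z : (EuclideanSpace ℝ (Fin d) × (ℝ × ℝ)) × (ℝ × ℝ) =>
        point (c z.1.1) t.1 := hcp.comp (by fun_prop)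
    refine Measurable.mul ((measurable_marginalDensity N R).comp (f := fun z :
      (EuclideanSpace ℝ (Fin d) × (ℝ × ℝ)) × (ℝ × ℝ) => (z.1.2, z.2))
      (by fun_prop)).ennreal_ofReal (Measurable.mul ?_ (hbm.comp ?_))
    · refine Measurable.ennreal_ofReal (Continuous.measurable ?_)
      exact ((continuous_cross.comp (f := fun z :
        (EuclideanSpace ℝ (Fin d) × (ℝ × ℝ)) × (ℝ × ℝ) => (velocity (c z.1.1) t.1, B • z.2))
        (by fun_prop)).abs).const_mul 2
    · exact Continuous.measurable (by fun_prop)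
  calc ∫⁻ w, ∫⁻ G in Metric.closedBall (0 : CurveSpace N) R, ENNReal.ofReal
        (2 * |cross (velocity (c w) t.1) (velocity G t.2)|) *
          b (Φ (differenceMap (c w) G t, w))
      = ∫⁻ w, ∫⁻ x : ℝ × ℝ, ∫⁻ q : ℝ × ℝ, k ((w, x), q) := by
        congr 1; ext w
        refine lintegral_closedBall_point_velocity hN hR t.2 (a := fun z : (ℝ × ℝ) × (ℝ × ℝ) =>
          ENNReal.ofReal (2 * |cross (velocity (c w) t.1) z.2|) *
            b (Φ (√2 • (z.1 - point (c w) t.1), w))) (Measurable.mul ?_ (hbm.comp ?_))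
        · refine Measurable.ennreal_ofReal (Continuous.measurable ?_)
          exact ((continuous_cross.comp (f := fun z : (ℝ × ℝ) × (ℝ × ℝ) =>
            (velocity (c w) t.1, z.2)) (by fun_prop)).abs).const_mul 2
        · exact Continuous.measurable (by fun_prop)
    _ = ∫⁻ q : ℝ × ℝ, ∫⁻ w, ∫⁻ x : ℝ × ℝ, k ((w, x), q) := by
        have e1 : ∀ w, ∫⁻ x : ℝ × ℝ, ∫⁻ q : ℝ × ℝ, k ((w, x), q)
            = ∫⁻ q : ℝ × ℝ, ∫⁻ x : ℝ × ℝ, k ((w, x), q) := fun w =>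
          lintegral_lintegral_swap (hkm.comp (f := fun z : (ℝ × ℝ) × (ℝ × ℝ) =>
            ((w, z.1), z.2)) (by fun_prop)).aemeasurable
        simp_rw [e1]
        refine lintegral_lintegral_swap (Measurable.aemeasurable ?_)
        exact Measurable.lintegral_prod_right' (f := fun z :
          (EuclideanSpace ℝ (Fin d) × (ℝ × ℝ)) × (ℝ × ℝ) => k ((z.1.1, z.2), z.1.2))
          (hkm.comp (by fun_prop))
    _ = ∫⁻ q : ℝ × ℝ, ENNReal.ofReal (2 * A ^ 2)⁻¹ *
          ∫⁻ F in Metric.closedBall (0 : CurveSpace N) R,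
            ENNReal.ofReal (marginalDensity N R (A⁻¹ • point F t.1) q) *
              ENNReal.ofReal (2 * |cross (velocity F t.1) (B • q)|) := by
        congr 1; ext q
        have hgm : Measurable fun F : CurveSpace N =>
            ENNReal.ofReal (marginalDensity N R (A⁻¹ • point F t.1) q) *
              ENNReal.ofReal (2 * |cross (velocity F t.1) (B • q)|) := by
          have hp : Continuous fun F : CurveSpace N => point F t.1 :=
            continuous_point_uncurry.comp (f := fun F => (F, t.1)) (by fun_prop)
          have hv : Continuous fun F : CurveSpace N => velocity F t.1 :=
            continuous_velocity_uncurry.comp (f := fun F => (F, t.1)) (by fun_prop)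
          refine Measurable.mul ((measurable_marginalDensity N R).comp (f := fun F :
            CurveSpace N => (A⁻¹ • point F t.1, q)) ?_).ennreal_ofReal
            (Measurable.ennreal_ofReal ?_)
          · exact Continuous.measurable (by fun_prop)
          · exact Continuous.measurable (((continuous_cross.comp (f := fun F :
              CurveSpace N => (velocity F t.1, B • q)) (by fun_prop)).abs).const_mul 2)
        -- The translation by `√2 • (A • x - point (c w) t.1)` carries the first curve at `t.1` to
        -- `A • x`, the position of the second at `t.2`. Hence `x` can be read off the first curve,
        -- and the integrand depends on the translated curve alone.
        have hsub (w : EuclideanSpace ℝ (Fin d)) (x : ℝ × ℝ) : k ((w, x), q)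
            = (fun y => b (Φ (y, w)) *
                (ENNReal.ofReal (marginalDensity N R (A⁻¹ • point (Φ (y, w)) t.1) q) *
                  ENNReal.ofReal (2 * |cross (velocity (Φ (y, w)) t.1) (B • q)|)))
                (√2 • (A • x - point (c w) t.1)) := by
          have h2 : √2 ≠ 0 := by positivity
          simp only [hk, hpt, hvel, inv_smul_smul₀ h2, sub_add_cancel, inv_smul_smul₀ hA0.ne']
          ring
        simp_rw [hsub]
        have hsc (w : EuclideanSpace ℝ (Fin d)) := lintegral_comp_sqrt_two_smul
          (f := fun y => b (Φ (y, w)) *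
            (ENNReal.ofReal (marginalDensity N R (A⁻¹ • point (Φ (y, w)) t.1) q) *
              ENNReal.ofReal (2 * |cross (velocity (Φ (y, w)) t.1) (B • q)|)))
          (((hbm.mul hgm).comp hΦ.measurable).comp (by fun_prop)) hA0 (point (c w) t.1)
        simp_rw [hsc]
        rw [lintegral_const_mul' _ _ ENNReal.ofReal_ne_top,
          setLIntegral_eq_lintegral_indicator_mul _ measurableSet_closedBall]
        congr 1
        -- The translation and the remaining coordinates reassemble into an integral over whole
        -- curves.
        exact (lintegral_prod_symm' _ ((hbm.mul hgm).comp hΦ.measurable)).symm.trans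
          (hΦ.lintegral_comp (hbm.mul hgm))
    _ = _ := by
        rw [lintegral_const_mul' _ _ ENNReal.ofReal_ne_top]
        congr 2; ext q
        rw [lintegral_closedBall_point_velocity hN hR t.1 (a := fun z : (ℝ × ℝ) × (ℝ × ℝ) =>
          ENNReal.ofReal (marginalDensity N R (A⁻¹ • z.1) q) *
            ENNReal.ofReal (2 * |cross z.2 (B • q)|))]
        · simp_rw [← hA, inv_smul_smul₀ hA0.ne', ← hB]
        · refine Measurable.mul ((measurable_marginalDensity N R).comp (f := fun z :
            (ℝ × ℝ) × (ℝ × ℝ) => (A⁻¹ • z.1, q)) (by fun_prop)).ennreal_ofReal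
            (Measurable.ennreal_ofReal ?_)
          exact Continuous.measurable (((continuous_cross.comp (f := fun z :
            (ℝ × ℝ) × (ℝ × ℝ) => (z.2, B • q)) (by fun_prop)).abs).const_mul 2)

/-- The integral of the number of intersection points over all pairs of curves in a ball. -/
theorem lintegral_ballPairs_intersectionNumber (hN : 0 < N) {R : ℝ} (hR : 0 ≤ R) :
    ∫⁻ p in ballPairs N R, (intersectionNumber p : ℝ≥0∞)
      = ENNReal.ofReal (4 * Real.pi ^ 2) * (ENNReal.ofReal (2 * pointScale N ^ 2)⁻¹ *
        ∫⁻ q : ℝ × ℝ, ∫⁻ x : ℝ × ℝ, ∫⁻ p : ℝ × ℝ, ENNReal.ofReal (marginalDensity N R x p) *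
          (ENNReal.ofReal (marginalDensity N R x q) *
            ENNReal.ofReal (2 * |cross (velocityScale N • p) (velocityScale N • q)|))) := by
  obtain ⟨d, Φ, c, hΦc, hc, hΦ, hpt, hvel⟩ := exists_measurePreserving_translation N
  set b : CurveSpace N → ℝ≥0∞ := (Metric.closedBall (0 : CurveSpace N) R).indicator 1 with hb
  have hbm : Measurable b := measurable_one.indicator measurableSet_closedBall
  have hI : Measurable fun p : CurveSpace N × CurveSpace N => (intersectionNumber p : ℝ≥0∞) :=
    (measurable_from_top (f := fun n : ℕ∞ => (n : ℝ≥0∞))).comp measurable_intersectionNumber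
  have hae : ∀ᵐ G : CurveSpace N, ∀ᵐ F : CurveSpace N,
      intersectionNumber (F, G) = (meetingParams (F, G)).encard := by
    have h2 := (Measure.measurePreserving_swap (μ := (volume : Measure (CurveSpace N)))
      (ν := (volume : Measure (CurveSpace N)))).quasiMeasurePreserving.ae
        (ae_intersectionNumber_eq hN)
    exact Measure.ae_ae_of_ae_prod h2
  -- the integrand of the area formula
  set k : (CurveSpace N × EuclideanSpace ℝ (Fin d)) × (ℝ × ℝ) → ℝ≥0∞ := fun z =>
    ENNReal.ofReal (2 * |cross (velocity (c z.1.2) z.2.1) (velocity z.1.1 z.2.2)|) *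
      b (Φ (differenceMap (c z.1.2) z.1.1 z.2, z.1.2)) with hk
  have hkm : Measurable k := by
    have c1 : Continuous fun z : (CurveSpace N × EuclideanSpace ℝ (Fin d)) × (ℝ × ℝ) =>
        velocity (c z.1.2) z.2.1 :=
      continuous_velocity_uncurry.comp (f := fun z : (CurveSpace N × EuclideanSpace ℝ (Fin d)) ×
        (ℝ × ℝ) => (c z.1.2, z.2.1)) (by fun_prop)
    have c2 : Continuous fun z : (CurveSpace N × EuclideanSpace ℝ (Fin d)) × (ℝ × ℝ) =>
        velocity z.1.1 z.2.2 :=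
      continuous_velocity_uncurry.comp (f := fun z : (CurveSpace N × EuclideanSpace ℝ (Fin d)) ×
        (ℝ × ℝ) => (z.1.1, z.2.2)) (by fun_prop)
    have c3 : Continuous fun z : (CurveSpace N × EuclideanSpace ℝ (Fin d)) × (ℝ × ℝ) =>
        point (c z.1.2) z.2.1 :=
      continuous_point_uncurry.comp (f := fun z : (CurveSpace N × EuclideanSpace ℝ (Fin d)) ×
        (ℝ × ℝ) => (c z.1.2, z.2.1)) (by fun_prop)
    have c4 : Continuous fun z : (CurveSpace N × EuclideanSpace ℝ (Fin d)) × (ℝ × ℝ) =>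
        point z.1.1 z.2.2 :=
      continuous_point_uncurry.comp (f := fun z : (CurveSpace N × EuclideanSpace ℝ (Fin d)) ×
        (ℝ × ℝ) => (z.1.1, z.2.2)) (by fun_prop)
    refine Measurable.mul (Measurable.ennreal_ofReal (Continuous.measurable ?_)) (hbm.comp ?_)
    · exact ((continuous_cross.comp (c1.prodMk c2)).abs).const_mul 2
    · unfold differenceMap
      exact Continuous.measurable (by fun_prop)
  calc ∫⁻ p in ballPairs N R, (intersectionNumber p : ℝ≥0∞)
      = ∫⁻ G in Metric.closedBall (0 : CurveSpace N) R,
          ∫⁻ F in Metric.closedBall (0 : CurveSpace N) R, (intersectionNumber (F, G) : ℝ≥0∞) := by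
        rw [ballPairs, Measure.volume_eq_prod, ← Measure.prod_restrict]
        exact lintegral_prod_symm' _ hI
    _ = ∫⁻ G in Metric.closedBall (0 : CurveSpace N) R,
          ∫⁻ w, ∫⁻ t in paramSquare, k ((G, w), t) := by
        refine lintegral_congr_ae (ae_restrict_of_ae ?_)
        filter_upwards [hae] with G hG
        rw [setLIntegral_eq_lintegral_indicator_mul _ measurableSet_closedBall]
        exact lintegral_intersectionNumber_mul hΦ hpt hG hbm
    _ = ∫⁻ t in paramSquare, ∫⁻ w,
          ∫⁻ G in Metric.closedBall (0 : CurveSpace N) R, k ((G, w), t) := by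
        have e1 : ∀ G, ∫⁻ w, ∫⁻ t in paramSquare, k ((G, w), t)
            = ∫⁻ t in paramSquare, ∫⁻ w, k ((G, w), t) := fun G =>
          lintegral_lintegral_swap (hkm.comp (f := fun z :
            EuclideanSpace ℝ (Fin d) × (ℝ × ℝ) => ((G, z.1), z.2)) (by fun_prop)).aemeasurable
        simp_rw [e1]
        rw [lintegral_lintegral_swap]
        · congr 1; ext t
          exact lintegral_lintegral_swap (hkm.comp (f := fun z :
            CurveSpace N × EuclideanSpace ℝ (Fin d) => (z, t)) (by fun_prop)).aemeasurable
        · exact (Measurable.lintegral_prod_right' (f := fun z :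
            (CurveSpace N × (ℝ × ℝ)) × EuclideanSpace ℝ (Fin d) => k ((z.1.1, z.2), z.1.2))
            (hkm.comp (by fun_prop))).aemeasurable
    _ = _ := by
        -- The inner integral does not depend on `t`, so the square of parameters contributes only
        -- its area.
        refine (lintegral_congr fun t =>
          lintegral_translation_lintegral hΦc hc hΦ hpt hvel hN hR t).trans ?_
        rw [setLIntegral_const, volume_paramSquare, mul_comm]

/-! ### Polar coordinates and radial moments -/

theorem integral_abs_sin_sub (α : ℝ) : ∫ θ in (-Real.pi)..Real.pi, |Real.sin (α - θ)| = 4 := by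
  have hper : Function.Periodic (fun θ => |Real.sin θ|) Real.pi := fun θ => by
    simp [Real.sin_add_pi]
  have hint (a b : ℝ) : IntervalIntegrable (fun θ => |Real.sin θ|) volume a b :=
    (Real.continuous_sin.abs).intervalIntegrable a b
  have h0 : ∫ θ in (0 : ℝ)..Real.pi, |Real.sin θ| = 2 := by
    have h2 : ∫ θ in (0 : ℝ)..Real.pi, Real.sin θ = 2 := by rw [integral_sin]; simp; norm_num
    rw [← h2]
    refine intervalIntegral.integral_congr fun θ hθ => ?_
    rw [uIcc_of_le Real.pi_pos.le] at hθ
    exact abs_of_nonneg (Real.sin_nonneg_of_mem_Icc hθ)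
  have h1 (t : ℝ) : ∫ θ in t..(t + Real.pi), |Real.sin θ| = 2 := by
    rw [hper.intervalIntegral_add_eq t 0, zero_add, h0]
  rw [intervalIntegral.integral_comp_sub_left (fun θ => |Real.sin θ|),
    ← intervalIntegral.integral_add_adjacent_intervals (hint (α - Real.pi) α) (hint α _)]
  have h2 := h1 (α - Real.pi)
  rw [sub_add_cancel] at h2
  rw [h2, sub_neg_eq_add, h1]
  norm_num

theorem setLIntegral_Ioo_eq_ofReal {a b : ℝ} (hab : a ≤ b) {f : ℝ → ℝ} (hf : Continuous f)
    (h0 : ∀ x ∈ Ioo a b, 0 ≤ f x) :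
    ∫⁻ x in Ioo a b, ENNReal.ofReal (f x) = ENNReal.ofReal (∫ x in a..b, f x) := by
  rw [intervalIntegral.integral_of_le hab, integral_Ioc_eq_integral_Ioo,
    ofReal_integral_eq_lintegral_ofReal]
  · exact (hf.integrableOn_Icc (a := a) (b := b)).mono_set Ioo_subset_Icc_self
  · exact (ae_restrict_mem measurableSet_Ioo).mono h0

/-- Polar coordinates for products of a radial and an angular function. -/
theorem lintegral_polar_mul {f : ℝ × ℝ → ℝ≥0∞} {ρ ω : ℝ → ℝ≥0∞} (hρ : Measurable ρ)
    (hω : Measurable ω)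
    (h : ∀ r θ, 0 < r → f (r * Real.cos θ, r * Real.sin θ) = ρ r * ω θ) :
    ∫⁻ p, f p = (∫⁻ r in Ioi (0 : ℝ), ENNReal.ofReal r * ρ r) *
      ∫⁻ θ in Ioo (-Real.pi) Real.pi, ω θ := by
  rw [← lintegral_comp_polarCoord_symm, polarCoord_target, Measure.volume_eq_prod,
    ← Measure.prod_restrict, ← lintegral_prod_mul (by fun_prop) hω.aemeasurable,
    Measure.prod_restrict]
  refine setLIntegral_congr_fun (measurableSet_Ioi.prod measurableSet_Ioo) fun z hz => ?_
  simp only [polarCoord_symm_apply, smul_eq_mul]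
  rw [h _ _ hz.1, mul_assoc]

theorem polar_sq_add_sq (r θ : ℝ) : (r * Real.cos θ) ^ 2 + (r * Real.sin θ) ^ 2 = r ^ 2 := by
  linear_combination r ^ 2 * Real.sin_sq_add_cos_sq θ

theorem lintegral_radial {h : ℝ → ℝ≥0∞} (hh : Measurable h) :
    ∫⁻ p : ℝ × ℝ, h (p.1 ^ 2 + p.2 ^ 2)
      = (∫⁻ r in Ioi (0 : ℝ), ENNReal.ofReal r * h (r ^ 2)) * ENNReal.ofReal (2 * Real.pi) := by
  rw [lintegral_polar_mul (ρ := fun r => h (r ^ 2)) (ω := fun _ => 1) (hh.comp (by fun_prop))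
    measurable_const fun r θ _ => by simp [polar_sq_add_sq]]
  simp [two_mul]

theorem lintegral_radial_mul_norm {h : ℝ → ℝ≥0∞} (hh : Measurable h) :
    ∫⁻ p : ℝ × ℝ, h (p.1 ^ 2 + p.2 ^ 2) * ENNReal.ofReal √(p.1 ^ 2 + p.2 ^ 2)
      = (∫⁻ r in Ioi (0 : ℝ), ENNReal.ofReal (r ^ 2) * h (r ^ 2)) *
        ENNReal.ofReal (2 * Real.pi) := by
  rw [lintegral_radial (h := fun s => h s * ENNReal.ofReal √s) (by fun_prop)]
  congr 1
  refine setLIntegral_congr_fun measurableSet_Ioi fun r hr => ?_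
  have hr0 : (0 : ℝ) ≤ r := le_of_lt hr
  simp only [Real.sqrt_sq hr0]
  rw [sq, ENNReal.ofReal_mul hr0]
  ring

/-- In polar coordinates the area is `r |q| |sin (α - θ)|` with `α` the argument of `q`, and the
angular integral of `|sin|` over a full turn is 4. -/
theorem lintegral_radial_mul_abs_cross {h : ℝ → ℝ≥0∞} (hh : Measurable h) (q : ℝ × ℝ) :
    ∫⁻ p : ℝ × ℝ, h (p.1 ^ 2 + p.2 ^ 2) * ENNReal.ofReal |cross p q|
      = (∫⁻ r in Ioi (0 : ℝ), ENNReal.ofReal (r ^ 2) * h (r ^ 2)) *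
        ENNReal.ofReal (4 * √(q.1 ^ 2 + q.2 ^ 2)) := by
  obtain ⟨s, α, hs, h1, h2⟩ : ∃ s α : ℝ, √(q.1 ^ 2 + q.2 ^ 2) = s ∧ q.1 = s * Real.cos α ∧
      q.2 = s * Real.sin α := by
    refine ⟨_, Complex.arg ⟨q.1, q.2⟩, rfl, ?_, ?_⟩
    · have := Complex.norm_mul_cos_arg ⟨q.1, q.2⟩
      rw [Complex.norm_def, Complex.normSq_mk, ← sq, ← sq] at this
      exact this.symm
    · have := Complex.norm_mul_sin_arg ⟨q.1, q.2⟩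
      rw [Complex.norm_def, Complex.normSq_mk, ← sq, ← sq] at this
      exact this.symm
  have hs0 : 0 ≤ s := hs ▸ Real.sqrt_nonneg _
  rw [hs, lintegral_polar_mul (ρ := fun r => h (r ^ 2) * ENNReal.ofReal r)
    (ω := fun θ => ENNReal.ofReal (s * |Real.sin (α - θ)|)) (by fun_prop) (by fun_prop)]
  · rw [setLIntegral_Ioo_eq_ofReal (by linarith [Real.pi_pos]) (by fun_prop)
      (fun θ _ => by positivity), intervalIntegral.integral_const_mul, integral_abs_sin_sub,
      mul_comm s]
    congr 1
    refine setLIntegral_congr_fun measurableSet_Ioi fun r hr => ?_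
    have hr0 : (0 : ℝ) ≤ r := le_of_lt hr
    rw [sq, ENNReal.ofReal_mul hr0]
    ring
  · intro r θ hr
    have : cross (r * Real.cos θ, r * Real.sin θ) q = r * (s * Real.sin (α - θ)) := by
      simp only [cross, h1, h2, Real.sin_sub]
      ring
    rw [this, abs_mul, abs_mul, abs_of_pos hr, abs_of_nonneg hs0, ENNReal.ofReal_mul hr.le,
      polar_sq_add_sq, mul_assoc]

/-- The radial moment `∫₀¹ u² (1 - u²)ᵏ du`. -/
noncomputable def radialMoment (k : ℕ) : ℝ := ∫ u in (0 : ℝ)..1, u ^ 2 * (1 - u ^ 2) ^ k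

theorem radialMoment_nonneg (k : ℕ) : 0 ≤ radialMoment k := by
  refine intervalIntegral.integral_nonneg zero_le_one fun u hu => ?_
  have : u ^ 2 ≤ 1 := pow_le_one₀ hu.1 hu.2
  exact mul_nonneg (sq_nonneg _) (pow_nonneg (by linarith) _)

theorem integral_sq_mul_sub_sq_pow {s : ℝ} (hs : 0 < s) (k : ℕ) :
    ∫ r in (0 : ℝ)..s, r ^ 2 * (s ^ 2 - r ^ 2) ^ k = s ^ (2 * k + 3) * radialMoment k := by
  have h := intervalIntegral.integral_comp_mul_left (a := 0) (b := 1)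
    (fun r => r ^ 2 * (s ^ 2 - r ^ 2) ^ k) hs.ne'
  rw [mul_zero, mul_one, smul_eq_mul, eq_inv_mul_iff_mul_eq₀ hs.ne'] at h
  rw [← h, radialMoment, ← intervalIntegral.integral_const_mul,
    ← intervalIntegral.integral_const_mul]
  congr 1; ext u
  have : s ^ 2 - (s * u) ^ 2 = s ^ 2 * (1 - u ^ 2) := by ring
  rw [this, mul_pow (s ^ 2), ← pow_mul]
  ring

/-- The truncated factor vanishes beyond `s`; this uses that `k` is positive. -/
theorem setLIntegral_Ioi_truncated {s : ℝ} (hs : 0 ≤ s) {g : ℝ → ℝ} (hg : Continuous g)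
    (hg0 : ∀ r, 0 ≤ r → 0 ≤ g r) {k : ℕ} (hk : 0 < k) :
    ∫⁻ r in Ioi (0 : ℝ), ENNReal.ofReal (g r * (max (s ^ 2 - r ^ 2) 0) ^ k)
      = ENNReal.ofReal (∫ r in (0 : ℝ)..s, g r * (s ^ 2 - r ^ 2) ^ k) := by
  have hz : ∀ r ∈ Ioi (0 : ℝ), r ∉ Ioo 0 s →
      ENNReal.ofReal (g r * (max (s ^ 2 - r ^ 2) 0) ^ k) = 0 := by
    intro r hr hrs
    have hsr : s ≤ r := by
      by_contra! h
      exact hrs ⟨hr, h⟩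
    have : s ^ 2 - r ^ 2 ≤ 0 := by nlinarith
    rw [max_eq_right this, zero_pow hk.ne']
    simp
  rw [← setLIntegral_Ioo_eq_ofReal hs (by fun_prop)]
  · rw [← lintegral_indicator measurableSet_Ioi, ← lintegral_indicator measurableSet_Ioo]
    congr 1; ext r
    by_cases h1 : r ∈ Ioo 0 s
    · have : 0 ≤ s ^ 2 - r ^ 2 := by nlinarith [h1.1, h1.2]
      rw [indicator_of_mem h1, indicator_of_mem (show r ∈ Ioi (0 : ℝ) from h1.1), max_eq_left this]
    · rw [indicator_of_notMem h1]
      by_cases h2 : r ∈ Ioi (0 : ℝ)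
      · rw [indicator_of_mem h2, hz r h2 h1]
      · rw [indicator_of_notMem h2]
  · intro r hr
    have : 0 ≤ s ^ 2 - r ^ 2 := by nlinarith [hr.1, hr.2]
    exact mul_nonneg (hg0 r hr.1.le) (pow_nonneg this k)

/-- The integral of the area of the parallelogram spanned by two vectors, against the radial
density `ω (T - |p|²)₊ᵏ` for both vectors. -/
theorem lintegral_lintegral_abs_cross {k : ℕ} (hk : 0 < k) {ω : ℝ} (hω : 0 ≤ ω) (T : ℝ) :
    ∫⁻ q : ℝ × ℝ, ∫⁻ p : ℝ × ℝ, ENNReal.ofReal (ω * (max (T - (p.1 ^ 2 + p.2 ^ 2)) 0) ^ k) *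
        (ENNReal.ofReal (ω * (max (T - (q.1 ^ 2 + q.2 ^ 2)) 0) ^ k) * ENNReal.ofReal |cross p q|)
      = ENNReal.ofReal (8 * Real.pi * ω ^ 2 * radialMoment k ^ 2 * (max T 0) ^ (2 * k + 3)) := by
  set h : ℝ → ℝ≥0∞ := fun s => ENNReal.ofReal (ω * (max (T - s) 0) ^ k) with hh
  have hhm : Measurable h := by fun_prop
  have hm : ∫⁻ r in Ioi (0 : ℝ), ENNReal.ofReal (r ^ 2) * h (r ^ 2)
      = ENNReal.ofReal (ω * √(max T 0) ^ (2 * k + 3) * radialMoment k) := by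
    rcases le_or_gt T 0 with hT | hT
    · rw [max_eq_right hT, Real.sqrt_zero, zero_pow (by omega), mul_zero, zero_mul,
        ENNReal.ofReal_zero]
      refine (setLIntegral_congr_fun measurableSet_Ioi fun r _ => ?_).trans lintegral_zero
      have : T - r ^ 2 ≤ 0 := by nlinarith [sq_nonneg r]
      simp [hh, max_eq_right this, hk.ne']
    · have e : ∀ r, ENNReal.ofReal (r ^ 2) * h (r ^ 2)
          = ENNReal.ofReal (ω * r ^ 2 * (max (√T ^ 2 - r ^ 2) 0) ^ k) := by
        intro r
        rw [hh, ← ENNReal.ofReal_mul (sq_nonneg r), Real.sq_sqrt hT.le]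
        congr 1; ring
      simp_rw [e]
      rw [setLIntegral_Ioi_truncated (Real.sqrt_nonneg T) (by fun_prop)
        (fun r _ => by positivity) hk]
      simp_rw [mul_assoc ω]
      rw [intervalIntegral.integral_const_mul, integral_sq_mul_sub_sq_pow (Real.sqrt_pos.2 hT),
        max_eq_left hT.le]
  have hin : ∀ q : ℝ × ℝ, ∫⁻ p : ℝ × ℝ, h (p.1 ^ 2 + p.2 ^ 2) *
      (h (q.1 ^ 2 + q.2 ^ 2) * ENNReal.ofReal |cross p q|)
      = (∫⁻ r in Ioi (0 : ℝ), ENNReal.ofReal (r ^ 2) * h (r ^ 2)) * 4 *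
        (h (q.1 ^ 2 + q.2 ^ 2) * ENNReal.ofReal √(q.1 ^ 2 + q.2 ^ 2)) := by
    intro q
    have e : ∀ p : ℝ × ℝ, h (p.1 ^ 2 + p.2 ^ 2) *
        (h (q.1 ^ 2 + q.2 ^ 2) * ENNReal.ofReal |cross p q|)
        = h (q.1 ^ 2 + q.2 ^ 2) * (h (p.1 ^ 2 + p.2 ^ 2) * ENNReal.ofReal |cross p q|) :=
      fun p => by ring
    simp_rw [e]
    rw [lintegral_const_mul' _ _ ENNReal.ofReal_ne_top, lintegral_radial_mul_abs_cross hhm,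
      ENNReal.ofReal_mul (p := 4) (by norm_num), ENNReal.ofReal_ofNat]
    ring
  have hβ := radialMoment_nonneg k
  calc _ = ∫⁻ q : ℝ × ℝ, (∫⁻ r in Ioi (0 : ℝ), ENNReal.ofReal (r ^ 2) * h (r ^ 2)) * 4 *
        (h (q.1 ^ 2 + q.2 ^ 2) * ENNReal.ofReal √(q.1 ^ 2 + q.2 ^ 2)) :=
        lintegral_congr hin
    _ = _ := by
      rw [lintegral_const_mul _ (by fun_prop), lintegral_radial_mul_norm hhm, hm,
        ← ENNReal.ofReal_ofNat, ← ENNReal.ofReal_mul (by positivity),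
        ← ENNReal.ofReal_mul (by positivity), ← ENNReal.ofReal_mul (by positivity)]
      congr 1
      -- The integrals over `p` and `q` give one such power each.
      have hq : √(max T 0) ^ (2 * k + 3) * √(max T 0) ^ (2 * k + 3) = (max T 0) ^ (2 * k + 3) := by
        rw [← mul_pow, Real.mul_self_sqrt (le_max_right _ _)]
      rw [← hq]
      ring

theorem integral_mul_sub_sq_pow (s : ℝ) (n : ℕ) :
    ∫ r in (0 : ℝ)..s, r * (s ^ 2 - r ^ 2) ^ n = s ^ (2 * n + 2) / (2 * (n + 1)) := by
  have hd : ∀ r ∈ uIcc 0 s, HasDerivAt (fun r : ℝ => -((s ^ 2 - r ^ 2) ^ (n + 1) / (2 * (n + 1))))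
      (r * (s ^ 2 - r ^ 2) ^ n) r := by
    intro r _
    have h1 : HasDerivAt (fun r : ℝ => s ^ 2 - r ^ 2) (-(2 * r)) r := by
      simpa using (hasDerivAt_pow 2 r).const_sub (s ^ 2)
    convert! ((h1.pow (n + 1)).div_const (2 * ((n : ℝ) + 1))).neg using 1
    push_cast
    field_simp
  rw [intervalIntegral.integral_eq_sub_of_hasDerivAt hd
    (Continuous.intervalIntegrable (by fun_prop) _ _)]
  simp
  ring

theorem lintegral_truncated_pow {n : ℕ} (hn : 0 < n) {R : ℝ} (hR : 0 ≤ R) :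
    ∫⁻ x : ℝ × ℝ, ENNReal.ofReal ((max (R ^ 2 - (x.1 ^ 2 + x.2 ^ 2)) 0) ^ n)
      = ENNReal.ofReal (Real.pi * R ^ (2 * n + 2) / (n + 1)) := by
  rw [lintegral_radial (h := fun s => ENNReal.ofReal ((max (R ^ 2 - s) 0) ^ n)) (by fun_prop)]
  have e : ∀ r ∈ Ioi (0 : ℝ), ENNReal.ofReal r * ENNReal.ofReal ((max (R ^ 2 - r ^ 2) 0) ^ n)
      = ENNReal.ofReal (r * (max (R ^ 2 - r ^ 2) 0) ^ n) :=
    fun r hr => (ENNReal.ofReal_mul (le_of_lt hr)).symm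
  rw [setLIntegral_congr_fun measurableSet_Ioi e,
    setLIntegral_Ioi_truncated (g := fun r => r) hR continuous_id (fun r hr => hr) hn,
    integral_mul_sub_sq_pow, ← ENNReal.ofReal_mul (by positivity)]
  congr 1
  field_simp

/-! ### The exact mean -/

/-- The mean number of intersection points. -/
noncomputable def meanValue (N : ℕ) : ℝ :=
  64 / 3 * (N : ℝ) ^ 3 * (N + 1) * (2 * N + 1) * radialMoment (2 * N - 1) ^ 2

theorem meanValue_nonneg (N : ℕ) : 0 ≤ meanValue N := by
  unfold meanValue; positivity

theorem volume_ballPairs (N : ℕ) {R : ℝ} (hR : 0 ≤ R) : volume (ballPairs N R)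
    = ENNReal.ofReal ((R ^ (4 * N + 2) * (Real.pi ^ (2 * N + 1) / ((2 * N + 1).factorial : ℝ))) ^ 2)
    := by
  have hfr : Module.finrank ℝ (CurveSpace N) = 2 * (2 * N + 1) := by
    rw [finrank_curveSpace]; ring
  rw [ballPairs, Measure.volume_eq_prod, Measure.prod_prod,
    InnerProductSpace.volume_closedBall_of_dim_even hfr, finrank_curveSpace,
    ← ENNReal.ofReal_pow hR, ← ENNReal.ofReal_mul (by positivity),
    ← ENNReal.ofReal_mul (by positivity), sq]

/-- The common position `x` is integrated last: once it is fixed, both velocities have the same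
radial density, with `T = R ^ 2 - |x| ^ 2`, and the result is again a power of the truncated `T`. -/
theorem lintegral_marginalDensity_abs_cross (hN : 0 < N) {R : ℝ} (hR : 0 ≤ R) :
    ∫⁻ q : ℝ × ℝ, ∫⁻ x : ℝ × ℝ, ∫⁻ p : ℝ × ℝ, ENNReal.ofReal (marginalDensity N R x p) *
        (ENNReal.ofReal (marginalDensity N R x q) *
          ENNReal.ofReal (2 * |cross (velocityScale N • p) (velocityScale N • q)|))
      = ENNReal.ofReal (2 * velocityScale N ^ 2) *
        (ENNReal.ofReal (8 * Real.pi * (Real.pi ^ (2 * N - 1) / ((2 * N - 1).factorial : ℝ)) ^ 2 *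
          radialMoment (2 * N - 1) ^ 2) *
        ENNReal.ofReal (Real.pi * R ^ (2 * (2 * (2 * N - 1) + 3) + 2) /
          ((2 * (2 * N - 1) + 3 : ℕ) + 1))) := by
  have hk : 0 < 2 * N - 1 := by omega
  have hpull (q x p : ℝ × ℝ) : ENNReal.ofReal (marginalDensity N R x p) *
      (ENNReal.ofReal (marginalDensity N R x q) *
        ENNReal.ofReal (2 * |cross (velocityScale N • p) (velocityScale N • q)|))
      = ENNReal.ofReal (2 * velocityScale N ^ 2) *
        (ENNReal.ofReal (marginalDensity N R x p) *
          (ENNReal.ofReal (marginalDensity N R x q) * ENNReal.ofReal |cross p q|)) := by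
    have : cross (velocityScale N • p) (velocityScale N • q) = velocityScale N ^ 2 * cross p q := by
      simp only [cross, Prod.smul_fst, Prod.smul_snd, smul_eq_mul]; ring
    rw [this, abs_mul, abs_of_nonneg (sq_nonneg _), ← mul_assoc 2,
      ENNReal.ofReal_mul (by positivity)]
    ring
  simp_rw [hpull, lintegral_const_mul' _ _ ENNReal.ofReal_ne_top]
  congr 1
  have hm : Measurable fun z : ((ℝ × ℝ) × (ℝ × ℝ)) × (ℝ × ℝ) =>
      ENNReal.ofReal (marginalDensity N R z.1.2 z.2) *
        (ENNReal.ofReal (marginalDensity N R z.1.2 z.1.1) *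
          ENNReal.ofReal |cross z.2 z.1.1|) := by
    have hmul {X : Type} [MeasurableSpace X] {f g : X → ℝ≥0∞} (hf : Measurable f)
        (hg : Measurable g) : Measurable fun x => f x * g x := hf.mul hg
    refine hmul ?_ (hmul ?_ ?_)
    · exact ((measurable_marginalDensity N R).comp (f := fun z :
        ((ℝ × ℝ) × (ℝ × ℝ)) × (ℝ × ℝ) => (z.1.2, z.2)) (by fun_prop)).ennreal_ofReal
    · exact ((measurable_marginalDensity N R).comp (f := fun z :
        ((ℝ × ℝ) × (ℝ × ℝ)) × (ℝ × ℝ) => (z.1.2, z.1.1)) (by fun_prop)).ennreal_ofReal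
    · exact (Continuous.measurable (continuous_cross.comp (f := fun z :
        ((ℝ × ℝ) × (ℝ × ℝ)) × (ℝ × ℝ) => (z.2, z.1.1)) (by fun_prop)).abs).ennreal_ofReal
  rw [lintegral_lintegral_swap hm.lintegral_prod_right'.aemeasurable]
  have hin (x : ℝ × ℝ) : ∫⁻ q : ℝ × ℝ, ∫⁻ p : ℝ × ℝ, ENNReal.ofReal (marginalDensity N R x p) *
      (ENNReal.ofReal (marginalDensity N R x q) * ENNReal.ofReal |cross p q|)
      = ENNReal.ofReal (8 * Real.pi * (Real.pi ^ (2 * N - 1) / ((2 * N - 1).factorial : ℝ)) ^ 2 *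
          radialMoment (2 * N - 1) ^ 2) *
        ENNReal.ofReal ((max (R ^ 2 - (x.1 ^ 2 + x.2 ^ 2)) 0) ^ (2 * (2 * N - 1) + 3)) := by
    rw [← ENNReal.ofReal_mul (by positivity)]
    exact lintegral_lintegral_abs_cross hk (by positivity) _
  simp_rw [hin]
  rw [lintegral_const_mul' _ _ ENNReal.ofReal_ne_top, lintegral_truncated_pow (by omega) hR]

/-- Both sides carry the power `R ^ (8 * N + 4)`, which is why the mean does not depend on the
radius. -/
theorem lintegral_intersectionNumber_eq (hN : 0 < N) {R : ℝ} (hR : 0 ≤ R) :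
    ∫⁻ p in ballPairs N R, (intersectionNumber p : ℝ≥0∞)
      = ENNReal.ofReal (meanValue N) * volume (ballPairs N R) := by
  rw [lintegral_ballPairs_intersectionNumber hN hR, lintegral_marginalDensity_abs_cross hN hR,
    volume_ballPairs N hR]
  have hA : pointScale N ^ 2 = (2 * N + 1) / 2 := Real.sq_sqrt (by positivity)
  have hB : velocityScale N ^ 2 = N * (N + 1) * (2 * N + 1) / 6 := Real.sq_sqrt (by positivity)
  rw [← ENNReal.ofReal_mul (by positivity), ← ENNReal.ofReal_mul (by positivity),
    ← ENNReal.ofReal_mul (by positivity), ← ENNReal.ofReal_mul (by positivity),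
    ← ENNReal.ofReal_mul (meanValue_nonneg N), hA, hB, meanValue]
  obtain ⟨n, rfl⟩ : ∃ n, N = n + 1 := ⟨N - 1, by omega⟩
  have e1 : 2 * (n + 1) - 1 = 2 * n + 1 := by omega
  have e2 : 2 * (n + 1) + 1 = (2 * n + 1) + 1 + 1 := by ring
  rw [e1, e2, Nat.factorial_succ (2 * n + 1 + 1), Nat.factorial_succ (2 * n + 1)]
  have h1 : ((2 * n + 1).factorial : ℝ) ≠ 0 := by positivity
  have e3 : R ^ (2 * (2 * (2 * n + 1) + 3) + 2) = (R ^ (4 * (n + 1) + 2)) ^ 2 := by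
    rw [← pow_mul]; congr 1; ring
  have e4 : Real.pi ^ (2 * n + 1 + 1 + 1) = Real.pi ^ (2 * n + 1) * Real.pi ^ 2 := by
    rw [← pow_add]
  rw [e3, e4]
  congr 1
  push_cast
  field_simp
  ring

/-- Finiteness of the integral forces the intersection number to be finite almost everywhere, so the
pairs with infinitely many common points do not count and the integral is the sum over the finite
levels. -/
theorem hasSum_intersectionNumber (hN : 0 < N) {R : ℝ} (hR : 0 < R) :
    HasSum (fun i : ℕ => (i : ℝ) * relVolume N R i) (meanValue N) := by
  have hv := volume_ballPairs N hR.le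
  have hv0 : 0 < volume.real (ballPairs N R) := by
    rw [Measure.real, hv, ENNReal.toReal_ofReal (by positivity)]
    positivity
  have hvt : volume (ballPairs N R) ≠ ∞ := hv ▸ ENNReal.ofReal_ne_top
  have hint := lintegral_intersectionNumber_eq hN hR.le
  have hfin : ENNReal.ofReal (meanValue N) * volume (ballPairs N R) ≠ ∞ :=
    ENNReal.mul_ne_top ENNReal.ofReal_ne_top hvt
  have hI : Measurable fun p : CurveSpace N × CurveSpace N => (intersectionNumber p : ℝ≥0∞) :=
    (measurable_from_top (f := fun n : ℕ∞ => (n : ℝ≥0∞))).comp measurable_intersectionNumber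
  have hlevel (n : ℕ) : MeasurableSet {p : CurveSpace N × CurveSpace N |
      intersectionNumber p = (n : ℕ∞)} :=
    measurable_intersectionNumber (measurableSet_singleton (n : ℕ∞))
  have hsum : ∑' n : ℕ, (n : ℝ≥0∞) * volume {p ∈ ballPairs N R | intersectionNumber p = (n : ℕ∞)}
      = ENNReal.ofReal (meanValue N) * volume (ballPairs N R) := by
    rw [← hint]
    have hlt : ∀ᵐ p ∂volume.restrict (ballPairs N R), (intersectionNumber p : ℝ≥0∞) < ∞ :=
      ae_lt_top hI (hint ▸ hfin)
    have hexp : ∀ᵐ p ∂volume.restrict (ballPairs N R), (intersectionNumber p : ℝ≥0∞)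
        = ∑' n : ℕ, {p | intersectionNumber p = (n : ℕ∞)}.indicator (fun _ => (n : ℝ≥0∞)) p := by
      filter_upwards [hlt] with p hp
      obtain ⟨m, hm⟩ : ∃ m : ℕ, intersectionNumber p = m := by
        refine ENat.ne_top_iff_exists.1 ?_ |>.imp fun m h => h.symm
        rintro h
        simp [h] at hp
      rw [tsum_eq_single m]
      · rw [indicator_of_mem (s := {p | intersectionNumber p = (m : ℕ∞)}) hm, hm,
          ENat.toENNReal_coe]
      · intro n hn
        have hnot : p ∉ {p | intersectionNumber p = (n : ℕ∞)} := by
          rw [mem_ofPred_eq, hm]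
          exact_mod_cast hn.symm
        rw [indicator_of_notMem hnot]
    rw [lintegral_congr_ae hexp, lintegral_tsum fun n =>
      (measurable_const.indicator (hlevel n)).aemeasurable]
    congr 1; ext n
    rw [lintegral_indicator_const (hlevel n), Measure.restrict_apply (hlevel n)]
    congr 2
    ext p
    exact and_comm
  have h1 := ENNReal.hasSum_toReal (hsum ▸ hfin)
  have hne (n : ℕ) : (n : ℝ≥0∞) * volume {p ∈ ballPairs N R | intersectionNumber p = (n : ℕ∞)}
      ≠ ∞ := ENNReal.ne_top_of_tsum_ne_top (hsum ▸ hfin) n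
  rw [← ENNReal.tsum_toReal_eq hne, hsum] at h1
  have h2 := h1.div_const (volume.real (ballPairs N R))
  simp only [ENNReal.toReal_mul, ENNReal.toReal_natCast,
    ENNReal.toReal_ofReal (meanValue_nonneg N)] at h2
  convert! h2 using 1
  · ext i
    rw [relVolume, mul_div_assoc]
    rfl
  · exact (mul_div_cancel_right₀ _ hv0.ne').symm

/-! ### Degree zero: constant curves -/

theorem intersectionNumber_le_one (p : CurveSpace 0 × CurveSpace 0) :
    intersectionNumber p ≤ 1 := by
  refine encard_le_one_iff.2 ?_
  rintro a b ⟨⟨φ, rfl⟩, -⟩ ⟨⟨ψ, rfl⟩, -⟩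
  simp [curve, component]

theorem relVolume_zero_eq_zero (R : ℝ) {i : ℕ} (hi : 2 ≤ i) : relVolume 0 R i = 0 := by
  have : {p ∈ ballPairs 0 R | intersectionNumber p = (i : ℕ∞)} = ∅ := by
    ext p
    simp only [mem_ofPred_eq, mem_empty_iff_false, iff_false, not_and]
    intro _ h
    have h1 := h ▸ intersectionNumber_le_one p
    have : i ≤ 1 := by exact_mod_cast h1
    omega
  rw [relVolume, this]
  simp

/-! ### Wallis bounds and asymptotics -/

/-- The Wallis integral `∫₀^{π/2} sinⁿ`. -/
noncomputable def wallisIntegral (n : ℕ) : ℝ := ∫ x in (0 : ℝ)..(Real.pi / 2), Real.sin x ^ n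

theorem wallisIntegral_add_two (n : ℕ) :
    (n + 2) * wallisIntegral (n + 2) = (n + 1) * wallisIntegral n := by
  unfold wallisIntegral
  rw [integral_sin_pow]
  simp
  field_simp

/-- The two-step recursion makes this product independent of `n`. As the integrals decrease in `n`,
the product bounds their squares from both sides. -/
theorem wallisIntegral_mul_succ (n : ℕ) :
    (n + 1) * (wallisIntegral n * wallisIntegral (n + 1)) = Real.pi / 2 := by
  induction n with
  | zero => simp [wallisIntegral]
  | succ n ih =>
    have := wallisIntegral_add_two n
    push_cast
    rw [← ih]
    linear_combination wallisIntegral (n + 1) * this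

theorem wallisIntegral_nonneg (n : ℕ) : 0 ≤ wallisIntegral n :=
  intervalIntegral.integral_nonneg (by positivity) fun _ hx =>
    pow_nonneg (Real.sin_nonneg_of_nonneg_of_le_pi hx.1 (by linarith [hx.2, Real.pi_pos])) n

theorem wallisIntegral_succ_le (n : ℕ) : wallisIntegral (n + 1) ≤ wallisIntegral n := by
  refine intervalIntegral.integral_mono_on (by positivity)
    ((Real.continuous_sin.pow _).intervalIntegrable _ _)
    ((Real.continuous_sin.pow _).intervalIntegrable _ _) fun x hx => ?_
  exact pow_le_pow_of_le_one
    (Real.sin_nonneg_of_nonneg_of_le_pi hx.1 (by linarith [hx.2, Real.pi_pos]))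
    (Real.sin_le_one x) (Nat.le_succ n)

theorem le_wallisIntegral_sq (n : ℕ) : Real.pi / 2 ≤ (n + 1) * wallisIntegral n ^ 2 := by
  rw [← wallisIntegral_mul_succ n, sq]
  exact mul_le_mul_of_nonneg_left
    (mul_le_mul_of_nonneg_left (wallisIntegral_succ_le n) (wallisIntegral_nonneg n))
    (by positivity)

theorem wallisIntegral_succ_sq_le (n : ℕ) :
    (n + 1) * wallisIntegral (n + 1) ^ 2 ≤ Real.pi / 2 := by
  rw [← wallisIntegral_mul_succ n, sq]
  exact mul_le_mul_of_nonneg_left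
    (mul_le_mul_of_nonneg_right (wallisIntegral_succ_le n) (wallisIntegral_nonneg _))
    (by positivity)

/-- The substitution `u = cos x` turns the moment into `∫ sin ^ (2 k + 1) cos ^ 2`, a difference of
two Wallis integrals, which the recursion reduces to one. -/
theorem radialMoment_eq (k : ℕ) :
    (2 * k + 3) * radialMoment k = wallisIntegral (2 * k + 1) := by
  have h := integral_sin_pow_odd_mul_cos_pow (a := 0) (b := Real.pi / 2) k 2
  rw [Real.cos_pi_div_two, Real.cos_zero] at h
  have h1 : radialMoment k = wallisIntegral (2 * k + 1) - wallisIntegral (2 * k + 1 + 2) := by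
    have hc (n : ℕ) : IntervalIntegrable (fun x => Real.sin x ^ n) volume 0 (Real.pi / 2) :=
      (Real.continuous_sin.pow n).intervalIntegrable _ _
    rw [radialMoment, ← h, wallisIntegral, wallisIntegral,
      ← intervalIntegral.integral_sub (hc _) (hc _)]
    congr 1; ext x
    rw [Real.cos_sq']
    ring
  have h2 := wallisIntegral_add_two (2 * k + 1)
  push_cast at h2
  rw [h1]
  linear_combination -h2

/-- The Wallis bounds place the mean between `π / 3 * N ^ 2` and `π / 3 * N * (N + 3)`; the gap is
exactly `π * N`. -/
theorem abs_meanValue_sub_le (hN : 0 < N) :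
    |meanValue N - Real.pi / 3 * (N : ℝ) ^ 2| ≤ Real.pi * N := by
  obtain ⟨n, rfl⟩ : ∃ n, N = n + 1 := ⟨N - 1, by omega⟩
  have e1 : 2 * (n + 1) - 1 = 2 * n + 1 := by omega
  have hβ := radialMoment_eq (2 * n + 1)
  have hlo := le_wallisIntegral_sq (2 * (2 * n + 1) + 1)
  have hhi := wallisIntegral_succ_sq_le (2 * (2 * n + 1))
  rw [← hβ] at hlo hhi
  push_cast at hlo hhi
  rw [meanValue, e1]
  push_cast
  set β := radialMoment (2 * n + 1)
  set x : ℝ := (n : ℝ) with hx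
  have hx0 : 0 ≤ x := Nat.cast_nonneg n
  have hpi := Real.pi_pos
  -- With `N = x + 1`, the moment is the Wallis integral of index `4 x + 3` divided by `4 x + 5`.
  have hlo' : Real.pi / (8 * (x + 1) * (4 * x + 5) ^ 2) ≤ β ^ 2 := by
    rw [div_le_iff₀ (by positivity)]
    nlinarith
  have hhi' : β ^ 2 ≤ Real.pi / (2 * (4 * x + 3) * (4 * x + 5) ^ 2) := by
    rw [le_div_iff₀ (by positivity)]
    nlinarith
  rw [abs_le]
  constructor
  · have h1 : 64 / 3 * (x + 1) ^ 3 * (x + 1 + 1) * (2 * (x + 1) + 1) *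
        (Real.pi / (8 * (x + 1) * (4 * x + 5) ^ 2)) ≤
        64 / 3 * (x + 1) ^ 3 * (x + 1 + 1) * (2 * (x + 1) + 1) * β ^ 2 :=
      mul_le_mul_of_nonneg_left hlo' (by positivity)
    have h2 : Real.pi / 3 * (x + 1) ^ 2 ≤ 64 / 3 * (x + 1) ^ 3 * (x + 1 + 1) *
        (2 * (x + 1) + 1) * (Real.pi / (8 * (x + 1) * (4 * x + 5) ^ 2)) := by
      have e : 64 / 3 * (x + 1) ^ 3 * (x + 1 + 1) *
        (2 * (x + 1) + 1) * (Real.pi / (8 * (x + 1) * (4 * x + 5) ^ 2))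
        = Real.pi / 3 * (x + 1) ^ 2 * (8 * (x + 2) * (2 * x + 3) / (4 * x + 5) ^ 2) := by
        field_simp
        ring
      rw [e]
      refine le_mul_of_one_le_right (by positivity) ?_
      rw [le_div_iff₀ (by positivity)]
      nlinarith
    have h3 : 0 ≤ Real.pi * (x + 1) := by positivity
    linarith
  · have h1 : 64 / 3 * (x + 1) ^ 3 * (x + 1 + 1) * (2 * (x + 1) + 1) * β ^ 2 ≤
        64 / 3 * (x + 1) ^ 3 * (x + 1 + 1) * (2 * (x + 1) + 1) *
        (Real.pi / (2 * (4 * x + 3) * (4 * x + 5) ^ 2)) :=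
      mul_le_mul_of_nonneg_left hhi' (by positivity)
    have h2 : 64 / 3 * (x + 1) ^ 3 * (x + 1 + 1) * (2 * (x + 1) + 1) *
        (Real.pi / (2 * (4 * x + 3) * (4 * x + 5) ^ 2)) ≤
        Real.pi / 3 * (x + 1) * (x + 4) := by
      have e : 64 / 3 * (x + 1) ^ 3 * (x + 1 + 1) * (2 * (x + 1) + 1) *
        (Real.pi / (2 * (4 * x + 3) * (4 * x + 5) ^ 2))
        = Real.pi / 3 * (x + 1) * (32 * (x + 1) ^ 2 * (x + 2) * (2 * x + 3) /
          ((4 * x + 3) * (4 * x + 5) ^ 2)) := by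
        field_simp
        ring
      rw [e]
      refine mul_le_mul_of_nonneg_left ?_ (by positivity)
      rw [div_le_iff₀ (by positivity)]
      have : 0 ≤ x ^ 3 := by positivity
      nlinarith [sq_nonneg x]
    linarith

end TrigCurve

theorem corollary1 :
    (∀ (N : ℕ) (R : ℝ), 0 < R → Summable fun i : ℕ => (i : ℝ) * TrigCurve.relVolume N R i) ∧
    ∃ C : ℝ, ∀ᶠ N : ℕ in Filter.atTop, ∀ R : ℝ, 0 < R →
      |(∑' i : ℕ, (i : ℝ) * TrigCurve.relVolume N R i) - Real.pi / 3 * (N : ℝ) ^ 2|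
        ≤ C * (N : ℝ) := by
  refine ⟨fun N R hR => ?_, Real.pi, ?_⟩
  · rcases N.eq_zero_or_pos with rfl | hN
    · refine summable_of_ne_finset_zero (s := Finset.range 2) fun i hi => ?_
      rw [TrigCurve.relVolume_zero_eq_zero R (by simpa [Nat.lt_iff_add_one_le] using hi),
        mul_zero]
    · exact (TrigCurve.hasSum_intersectionNumber hN hR).summable
  · filter_upwards [Filter.eventually_gt_atTop 0] with N hN R hR
    rw [(TrigCurve.hasSum_intersectionNumber hN hR).tsum_eq]
    exact TrigCurve.abs_meanValue_sub_le hN
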